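/- **Notation.** For $z=\xi+i\eta\in\mathbb C^n$ and $t\in\mathbb R^n$ let $z\cdot t=\sum_j z_jt_j$, and $\widehat\varphi(\xi)=\int e^{-2\pi i x\cdot\xi}\varphi(x)\,dx$. Let $\mathcal K_1(\mathbb R^n)$ be the space of all $\varphi\in C^\infty(\mathbb R^n)$ with $\sup_{t}e^{k|t|}|\varphi^{(\alpha)}(t)|<\infty$ for all $k\in\mathbb N_0$ and all multi-indices $\alpha$, with the topology given by these seminorms, and $\mathcal K_1'(\mathbb R^n)$ its dual. Let $\Sigma_1^1(\mathbb R^n)\subset\mathcal K_1(\mathbb R^n)$ be the space of all entire functions $\varphi$ with $\sup_{x\in\mathbb R^n}e^{\lambda|x|}|\varphi(x)|<\infty$ and $\sup_{\xi\in\mathbb R^n}e^{\lambda|\xi|}|\widehat\varphi(\xi)|<\infty$ for all $\lambda>0$, with the topology given by these seminorms, and $(\Sigma_1^1)'(\mathbb R^n)$ its dual. Whenever the (bilinear) dual pairing is defined, the short-time Fourier transform is $$V_\psi f(x,z)=\big\langle f(t),\,e^{-2\pi i z\cdot t}\,\overline{\psi(t-x)}\big\rangle ,$$ namely for $x,z=\xi\in\mathbb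 R^n$ if $f\in(\Sigma_1^1)'(\mathbb R^n)$, $\psi\in\Sigma_1^1(\mathbb R^n)$, and for $x\in\mathbb R^n$, $z\in\mathbb C^n$ if $f\in\mathcal K_1'(\mathbb R^n)$, $\psi\in\mathcal K_1(\mathbb R^n)$. Let $\mathfrak M_1$ be the class of all measurable, locally bounded $m:\mathbb R^{2n}\to(0,\infty)$ for which there are $A>0$ and $a,s\ge 0$ with $$\frac{m(x_1+x_2,\xi_1+\xi_2)}{m(x_1,\xi_1)}\le A\,e^{a|x_2|}(1+|\xi_2|)^s\qquad\text{for all }(x_1,\xi_1),(x_2,\xi_2)\in\mathbb R^{2n}.$$ For $p,q\in[1,\infty]$ let $\|F\|_{L^{p,q}_m}=\Big(\int_{\mathbb R^n}\Big(\int_{\mathbb R^n}|F(x,\xi)m(x,\xi)|^p\,dx\Big)^{q/p}d\xi\Big)^{1/q}$, with the usual changes if $p=\infty$ or $q=\infty$. Fix $\varphi\in\Sigma_1^1(\mathbb R^n)\setminus\{0\}$ and let $$M^{p,q}_m(\mathbb R^n)=\{f\in(\Sigma_1^1)'(\mathbb R^n):\ \|f\|_{M^{p,q}_m}:=\|V_\varphi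 f\|_{L^{p,q}_m}<\infty\}.$$ **Proposition.** Let $m\in\mathfrak M_1$, $p,q\in[1,\infty]$ and $\psi\in\mathcal K_1(\mathbb R^n)\setminus\{0\}$. Every $f\in M^{p,q}_m(\mathbb R^n)$ has a unique extension to an element of $\mathcal K_1'(\mathbb R^n)$, again denoted by $f$, so that $V_\psi f(x,z)$ is defined for $x\in\mathbb R^n$, $z\in\mathbb C^n$; for each $x$ it is an entire function of $z$. For every $\lambda\ge 0$ there is a constant $C_\lambda>0$, independent of $f$, such that for all $f\in M^{p,q}_m(\mathbb R^n)$ $$\sup_{|\eta|\le\lambda}\left(\int_{\mathbb R^n}\left(\int_{\mathbb R^n}\big|e^{-2\pi x\cdot\eta}\,V_\psi f(x,\xi+i\eta)\,m(x,\xi)\big|^p\,dx\right)^{q/p}d\xi\right)^{1/q}\le C_\lambda\,\|f\|_{M^{p,q}_m}$$ (with the usual changes if $p=\infty$ or $q=\infty$). The same holds, with a constant that also depends on $\gamma$, if the norm on the right-hand side is computed with a window $\gamma\in\mathcal K_1(\mathbb R^n)\setminus\{0\}$ instead of $\varphi$, that is, with $\|V_\gamma f\|_{L^{p,q}_m}$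 in place of $\|f\|_{M^{p,q}_m}$. -/

import Mathlib

open MeasureTheory
open scoped FourierTransform ENNReal ContDiff ComplexConjugate

noncomputable section

/-- The Euclidean space `ℝⁿ`. -/
abbrev RSpace (n : ℕ) : Type := EuclideanSpace ℝ (Fin n)

/-- The bilinear expression `z · t = ∑ⱼ zⱼ tⱼ` for `z ∈ ℂⁿ`, `t ∈ ℝⁿ`. -/
def cdot {n : ℕ} (z : Fin n → ℂ) (t : RSpace n) : ℂ := ∑ j, z j * (t j : ℂ)

/-- The point `ξ + i η` of `ℂⁿ`. -/
def complexPoint {n : ℕ} (ξ η : RSpace n) : Fin n → ℂ :=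
  fun j => (ξ j : ℂ) + (η j : ℂ) * Complex.I

/-- The function `t ↦ conj (M_z T_x ψ (t))` for real `z`, continued holomorphically to `z ∈ ℂⁿ`:
`t ↦ e^{-2π i z·t} conj (ψ (t - x))`. -/
def timeFreqFun {n : ℕ} (ψ : RSpace n → ℂ) (x : RSpace n) (z : Fin n → ℂ) : RSpace n → ℂ :=
  fun t => Complex.exp (-2 * Real.pi * Complex.I * cdot z t) * conj (ψ (t - x))

/-- The seminorm `v ↦ sup_x w(x) ‖T v x‖`. -/
def supSeminorm {V X G : Type*} [AddCommGroup V] [Module ℂ V] [Nonempty X]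
    [NormedAddCommGroup G] [NormedSpace ℂ G] (w : X → ℝ) (hw : ∀ x, 0 ≤ w x)
    (T : V →ₗ[ℂ] (X → G)) (h : ∀ v, BddAbove (Set.range fun x => w x * ‖T v x‖)) :
    Seminorm ℂ V :=
  Seminorm.of (fun v => ⨆ x, w x * ‖T v x‖)
    (by
      intro u v
      refine ciSup_le fun x => ?_
      have h1 := le_ciSup (h u) x
      have h2 := le_ciSup (h v) x
      have h3 : ‖T (u + v) x‖ ≤ ‖T u x‖ + ‖T v x‖ := by
        rw [map_add]; exact norm_add_le _ _
      have h4 := mul_le_mul_of_nonneg_left h3 (hw x)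
      linarith)
    (by
      intro a v
      have : ∀ x, w x * ‖T (a • v) x‖ = ‖a‖ * (w x * ‖T v x‖) := by
        intro x
        rw [map_smul, Pi.smul_apply, norm_smul]; ring
      simp only [this]
      exact (Real.mul_iSup_of_nonneg (norm_nonneg a) _).symm)

/-! ### The Hasumi-Silva space of exponentially rapidly decreasing smooth functions -/

/-- The `ℂ`-vector space of all `φ ∈ C^∞(ℝⁿ)` all of whose derivatives decay faster than
`e^{-k|t|}` for every `k`. -/
def k1Submodule (n : ℕ) : Submodule ℂ (RSpace n → ℂ) where
  carrier := {φ | ContDiff ℝ ∞ φ ∧ ∀ k j : ℕ, ∃ C : ℝ, ∀ t,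
    Real.exp (k * ‖t‖) * ‖iteratedFDeriv ℝ j φ t‖ ≤ C}
  add_mem' := by
    rintro f g ⟨hf, hf'⟩ ⟨hg, hg'⟩
    refine ⟨hf.add hg, fun k j => ?_⟩
    obtain ⟨C, hC⟩ := hf' k j
    obtain ⟨D, hD⟩ := hg' k j
    refine ⟨C + D, fun t => ?_⟩
    rw [iteratedFDeriv_add_apply (hf.contDiffAt.of_le (by exact_mod_cast le_top))
      (hg.contDiffAt.of_le (by exact_mod_cast le_top))]
    have := mul_le_mul_of_nonneg_left
      (norm_add_le (iteratedFDeriv ℝ j f t) (iteratedFDeriv ℝ j g t))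
      (Real.exp_pos (k * ‖t‖)).le
    linarith [hC t, hD t]
  zero_mem' := by
    refine ⟨contDiff_const, fun k j => ⟨0, fun t => ?_⟩⟩
    have h0 : (0 : RSpace n → ℂ) = fun _ => 0 := rfl
    rw [h0, iteratedFDeriv_fun_zero]
    simp
  smul_mem' := by
    rintro c f ⟨hf, hf'⟩
    refine ⟨contDiff_const.smul hf, fun k j => ?_⟩
    obtain ⟨C, hC⟩ := hf' k j
    refine ⟨‖c‖ * C, fun t => ?_⟩
    rw [iteratedFDeriv_const_smul_apply (hf.contDiffAt.of_le (by exact_mod_cast le_top)),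
      norm_smul]
    have := mul_le_mul_of_nonneg_left (hC t) (norm_nonneg c)
    linarith

/-- The Hasumi-Silva test function space `𝒦₁(ℝⁿ)`. -/
def K1 (n : ℕ) : Type := k1Submodule n

instance (n : ℕ) : AddCommGroup (K1 n) := inferInstanceAs (AddCommGroup (k1Submodule n))

instance (n : ℕ) : Module ℂ (K1 n) := inferInstanceAs (Module ℂ (k1Submodule n))

instance (n : ℕ) : CoeFun (K1 n) (fun _ => RSpace n → ℂ) := ⟨fun φ => φ.1⟩

/-- The linear map `φ ↦ D^j φ` on `𝒦₁(ℝⁿ)`. -/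
def K1.iteratedDerivₗ (n j : ℕ) :
    K1 n →ₗ[ℂ] (RSpace n → ContinuousMultilinearMap ℝ (fun _ : Fin j => RSpace n) ℂ) where
  toFun φ := iteratedFDeriv ℝ j φ
  map_add' φ χ := by
    funext t
    exact iteratedFDeriv_add_apply (φ.2.1.contDiffAt.of_le (by exact_mod_cast le_top))
      (χ.2.1.contDiffAt.of_le (by exact_mod_cast le_top))
  map_smul' c φ := by
    funext t
    exact iteratedFDeriv_const_smul_apply (φ.2.1.contDiffAt.of_le (by exact_mod_cast le_top))

/-- The seminorms `φ ↦ sup_t e^{k|t|} ‖D^j φ(t)‖` of `𝒦₁(ℝⁿ)`, indexed by `(k, j)`. -/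
def K1.seminormFamily (n : ℕ) : SeminormFamily ℂ (K1 n) (ℕ × ℕ) := fun kj =>
  supSeminorm (fun t => Real.exp (kj.1 * ‖t‖)) (fun _ => (Real.exp_pos _).le)
    (K1.iteratedDerivₗ n kj.2) (by
      intro φ
      obtain ⟨C, hC⟩ := φ.2.2 kj.1 kj.2
      exact ⟨C, by rintro _ ⟨t, rfl⟩; exact hC t⟩)

instance (n : ℕ) : TopologicalSpace (K1 n) := (K1.seminormFamily n).moduleFilterBasis.topology

theorem K1.withSeminorms (n : ℕ) : WithSeminorms (K1.seminormFamily n) := ⟨rfl⟩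

/-- The space `𝒦₁'(ℝⁿ)` of distributions of exponential type. -/
abbrev K1Dual (n : ℕ) : Type := K1 n →L[ℂ] ℂ

/-! ### The Gelfand-Shilov space of Beurling type -/

theorem integrable_of_exp_decay {n : ℕ} {φ : RSpace n → ℂ} (hc : Continuous φ)
    (hd : ∀ k : ℕ, ∃ C : ℝ, ∀ t, Real.exp (k * ‖t‖) * ‖φ t‖ ≤ C) : Integrable φ := by
  obtain ⟨C, hC⟩ := hd (n + 1)
  have h1 : Integrable (fun t : RSpace n => C * (1 + ‖t‖) ^ (-((n + 1 : ℕ) : ℝ))) := by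
    refine (integrable_one_add_norm ?_).const_mul C
    simp
  refine h1.mono' hc.aestronglyMeasurable (Filter.Eventually.of_forall fun t => ?_)
  have hp : (0 : ℝ) < 1 + ‖t‖ := by positivity
  have h2 : (1 + ‖t‖) ^ (n + 1) ≤ Real.exp ((n + 1 : ℕ) * ‖t‖) := by
    rw [Real.exp_nat_mul]
    gcongr
    linarith [Real.add_one_le_exp ‖t‖]
  rw [Real.rpow_neg hp.le, Real.rpow_natCast, ← div_eq_mul_inv, le_div_iff₀ (by positivity),
    mul_comm]
  exact (mul_le_mul_of_nonneg_right h2 (norm_nonneg _)).trans (hC t)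

theorem continuous_of_entire_ext {n : ℕ} {φ : RSpace n → ℂ} {Φ : (Fin n → ℂ) → ℂ}
    (h : Differentiable ℂ Φ) (h' : ∀ t : RSpace n, Φ (fun j => (t j : ℂ)) = φ t) :
    Continuous φ := by
  have h1 : φ = fun t : RSpace n => Φ (fun j => (t j : ℂ)) := funext fun t => (h' t).symm
  rw [h1]
  exact h.continuous.comp (by fun_prop)

theorem integrable_of_entire_ext {n : ℕ} {φ : RSpace n → ℂ}
    (he : ∃ Φ : (Fin n → ℂ) → ℂ, Differentiable ℂ Φ ∧
      ∀ t : RSpace n, Φ (fun j => (t j : ℂ)) = φ t)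
    (hd : ∀ k : ℕ, ∃ C : ℝ, ∀ t, Real.exp (k * ‖t‖) * ‖φ t‖ ≤ C) : Integrable φ := by
  obtain ⟨Φ, h, h'⟩ := he
  exact integrable_of_exp_decay (continuous_of_entire_ext h h') hd

/-- The `ℂ`-vector space of all (restrictions to `ℝⁿ` of) entire functions `φ` on `ℂⁿ` such that
`φ` and its Fourier transform decay faster than every exponential on `ℝⁿ`. -/
def gelfandShilovSubmodule (n : ℕ) : Submodule ℂ (RSpace n → ℂ) where
  carrier := {φ | (∃ Φ : (Fin n → ℂ) → ℂ, Differentiable ℂ Φ ∧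
      ∀ t : RSpace n, Φ (fun j => (t j : ℂ)) = φ t) ∧
    (∀ k : ℕ, ∃ C : ℝ, ∀ t, Real.exp (k * ‖t‖) * ‖φ t‖ ≤ C) ∧
    (∀ k : ℕ, ∃ C : ℝ, ∀ ξ, Real.exp (k * ‖ξ‖) * ‖𝓕 φ ξ‖ ≤ C)}
  add_mem' := by
    rintro f g ⟨hf, hf1, hf2⟩ ⟨hg, hg1, hg2⟩
    have hfi := integrable_of_entire_ext hf hf1
    have hgi := integrable_of_entire_ext hg hg1
    obtain ⟨Φ, hΦ, hΦ'⟩ := hf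
    obtain ⟨Γ, hΓ, hΓ'⟩ := hg
    refine ⟨⟨Φ + Γ, hΦ.add hΓ, fun t => by simp [hΦ', hΓ']⟩, fun k => ?_, fun k => ?_⟩
    · obtain ⟨C, hC⟩ := hf1 k
      obtain ⟨D, hD⟩ := hg1 k
      refine ⟨C + D, fun t => ?_⟩
      have := mul_le_mul_of_nonneg_left (norm_add_le (f t) (g t)) (Real.exp_pos (k * ‖t‖)).le
      rw [Pi.add_apply]
      linarith [hC t, hD t]
    · obtain ⟨C, hC⟩ := hf2 k
      obtain ⟨D, hD⟩ := hg2 k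
      refine ⟨C + D, fun t => ?_⟩
      have := mul_le_mul_of_nonneg_left (norm_add_le (𝓕 f t) (𝓕 g t)) (Real.exp_pos (k * ‖t‖)).le
      rw [show 𝓕 (f + g) = 𝓕 f + 𝓕 g from
        VectorFourier.fourierIntegral_add Real.continuous_fourierChar
          continuous_inner hfi hgi, Pi.add_apply]
      linarith [hC t, hD t]
  zero_mem' := by
    refine ⟨⟨0, differentiable_const 0, fun t => rfl⟩, fun k => ⟨0, fun t => by simp⟩,
      fun k => ⟨0, fun t => by simp [Real.fourier_eq]⟩⟩
  smul_mem' := by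
    rintro c f ⟨⟨Φ, hΦ, hΦ'⟩, hf1, hf2⟩
    refine ⟨⟨c • Φ, hΦ.const_smul c, fun t => by simp [hΦ']⟩, fun k => ?_, fun k => ?_⟩
    · obtain ⟨C, hC⟩ := hf1 k
      refine ⟨‖c‖ * C, fun t => ?_⟩
      have := mul_le_mul_of_nonneg_left (hC t) (norm_nonneg c)
      rw [Pi.smul_apply, norm_smul]
      linarith
    · obtain ⟨C, hC⟩ := hf2 k
      refine ⟨‖c‖ * C, fun t => ?_⟩
      have := mul_le_mul_of_nonneg_left (hC t) (norm_nonneg c)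
      rw [show 𝓕 (c • f) = c • 𝓕 f from VectorFourier.fourierIntegral_const_smul _ _ _ _ _,
        Pi.smul_apply, norm_smul]
      linarith

/-- The Gelfand-Shilov space `Σ₁¹(ℝⁿ)`. -/
def GelfandShilov (n : ℕ) : Type := gelfandShilovSubmodule n

instance (n : ℕ) : AddCommGroup (GelfandShilov n) :=
  inferInstanceAs (AddCommGroup (gelfandShilovSubmodule n))

instance (n : ℕ) : Module ℂ (GelfandShilov n) :=
  inferInstanceAs (Module ℂ (gelfandShilovSubmodule n))

instance (n : ℕ) : CoeFun (GelfandShilov n) (fun _ => RSpace n → ℂ) := ⟨fun φ => φ.1⟩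

/-- The inclusion of `Σ₁¹(ℝⁿ)` in the space of all functions. -/
def GelfandShilov.coeₗ (n : ℕ) : GelfandShilov n →ₗ[ℂ] (RSpace n → ℂ) :=
  (gelfandShilovSubmodule n).subtype

theorem GelfandShilov.integrable {n : ℕ} (φ : GelfandShilov n) : Integrable φ :=
  integrable_of_entire_ext φ.2.1 φ.2.2.1

/-- The Fourier transform on `Σ₁¹(ℝⁿ)`. -/
def GelfandShilov.fourierₗ (n : ℕ) : GelfandShilov n →ₗ[ℂ] (RSpace n → ℂ) where
  toFun φ := 𝓕 (φ : RSpace n → ℂ)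
  map_add' φ χ := VectorFourier.fourierIntegral_add Real.continuous_fourierChar
    continuous_inner φ.integrable χ.integrable
  map_smul' _ _ := VectorFourier.fourierIntegral_const_smul _ _ _ _ _

/-- The seminorms `φ ↦ sup_t e^{k|t|} |φ(t)| + sup_ξ e^{k|ξ|} |φ̂(ξ)|` of `Σ₁¹(ℝⁿ)`. -/
def GelfandShilov.seminormFamily (n : ℕ) : SeminormFamily ℂ (GelfandShilov n) ℕ := fun k =>
  supSeminorm (fun t => Real.exp (k * ‖t‖)) (fun _ => (Real.exp_pos _).le)
    (GelfandShilov.coeₗ n) (by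
      intro φ
      obtain ⟨C, hC⟩ := φ.2.2.1 k
      exact ⟨C, by rintro _ ⟨t, rfl⟩; exact hC t⟩) +
  supSeminorm (fun ξ => Real.exp (k * ‖ξ‖)) (fun _ => (Real.exp_pos _).le)
    (GelfandShilov.fourierₗ n) (by
      intro φ
      obtain ⟨C, hC⟩ := φ.2.2.2 k
      exact ⟨C, by rintro _ ⟨t, rfl⟩; exact hC t⟩)

instance (n : ℕ) : TopologicalSpace (GelfandShilov n) :=
  (GelfandShilov.seminormFamily n).moduleFilterBasis.topology

theorem GelfandShilov.withSeminorms (n : ℕ) :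
    WithSeminorms (GelfandShilov.seminormFamily n) := ⟨rfl⟩

/-- The dual `(Σ₁¹)'(ℝⁿ)`. -/
abbrev GelfandShilovDual (n : ℕ) : Type := GelfandShilov n →L[ℂ] ℂ

/-! ### The short-time Fourier transform -/

/-- The real-linear form `t ↦ -2π i z·t`. -/
def expForm {n : ℕ} (z : Fin n → ℂ) : RSpace n →L[ℝ] ℂ :=
  LinearMap.toContinuousLinearMap
    { toFun := fun t => -2 * Real.pi * Complex.I * cdot z t
      map_add' := by
        intro s t
        simp only [cdot, PiLp.add_apply, Complex.ofReal_add, mul_add, Finset.sum_add_distrib]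
      map_smul' := by
        intro c t
        simp only [cdot, PiLp.smul_apply, smul_eq_mul, Complex.ofReal_mul, RingHom.id_apply,
          Complex.real_smul, Finset.mul_sum]
        refine Finset.sum_congr rfl fun j _ => ?_
        ring }

theorem norm_iteratedFDeriv_exp_le {n : ℕ} (L : RSpace n →L[ℝ] ℂ) (j : ℕ) :
    ∃ C : ℝ, 0 ≤ C ∧ ∀ t, ‖iteratedFDeriv ℝ j (fun t => Complex.exp (L t)) t‖ ≤
      C * Real.exp (‖L‖ * ‖t‖) := by
  induction j with
  | zero =>
    refine ⟨1, zero_le_one, fun t => ?_⟩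
    rw [norm_iteratedFDeriv_zero, Complex.norm_exp, one_mul, Real.exp_le_exp]
    exact (Complex.re_le_norm _).trans (L.le_opNorm t)
  | succ j ih =>
    obtain ⟨C, hC0, hC⟩ := ih
    let A : ℂ →L[ℝ] (RSpace n →L[ℝ] ℂ) :=
      ContinuousLinearMap.flip (ContinuousLinearMap.compL ℝ (RSpace n) ℂ ℂ) L ∘L
        ContinuousLinearMap.mul ℝ ℂ
    have hs : ContDiff ℝ ∞ (fun t => Complex.exp (L t)) :=
      Complex.contDiff_exp.comp L.contDiff
    have hA : fderiv ℝ (fun t => Complex.exp (L t)) = A ∘ fun t => Complex.exp (L t) := by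
      funext t
      have h1 : HasFDerivAt (fun t => Complex.exp (L t)) (Complex.exp (L t) • L) t :=
        L.hasFDerivAt.cexp
      rw [h1.fderiv]
      ext v
      simp [A]
    refine ⟨‖A‖ * C, by positivity, fun t => ?_⟩
    rw [← norm_iteratedFDeriv_fderiv, hA]
    refine (A.norm_iteratedFDeriv_comp_left (N := ∞) hs.contDiffAt
      (by exact_mod_cast le_top)).trans ?_
    rw [mul_assoc]
    exact mul_le_mul_of_nonneg_left (hC t) (norm_nonneg _)

theorem timeFreqFun_mem_k1 {n : ℕ} {ψ : RSpace n → ℂ} (hψ : ψ ∈ k1Submodule n) (x : RSpace n)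
    (z : Fin n → ℂ) : timeFreqFun ψ x z ∈ k1Submodule n := by
  obtain ⟨hs, hd⟩ := hψ
  have he : ContDiff ℝ ∞ (fun t : RSpace n => Complex.exp (expForm z t)) :=
    Complex.contDiff_exp.comp (expForm z).contDiff
  have hs1 : ContDiff ℝ ∞ (fun t : RSpace n => ψ (t - x)) := by fun_prop
  have hs2 : ContDiff ℝ ∞ (fun t : RSpace n => conj (ψ (t - x))) :=
    Complex.conjCLE.contDiff.comp hs1
  have hj : ∀ (i : ℕ) (t : RSpace n), ‖iteratedFDeriv ℝ i (fun t => conj (ψ (t - x))) t‖ =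
      ‖iteratedFDeriv ℝ i ψ (t - x)‖ := by
    intro i t
    have h1 := Complex.conjLIE.norm_iteratedFDeriv_comp_left (fun t : RSpace n => ψ (t - x)) t i
    rw [iteratedFDeriv_comp_sub] at h1
    exact h1
  refine ⟨he.mul hs2, fun k j => ?_⟩
  choose C hC0 hC using norm_iteratedFDeriv_exp_le (expForm z)
  obtain ⟨N, hN⟩ := exists_nat_ge (k + ‖expForm z‖)
  choose D hD using hd N
  refine ⟨∑ i ∈ Finset.range (j + 1),
    (j.choose i : ℝ) * C i * (Real.exp (N * ‖x‖) * D (j - i)), fun t => ?_⟩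
  have h1 := norm_iteratedFDeriv_mul_le he hs2 t (n := j) (by exact_mod_cast le_top)
  refine (mul_le_mul_of_nonneg_left h1 (Real.exp_pos _).le).trans ?_
  rw [Finset.mul_sum]
  refine Finset.sum_le_sum fun i _ => ?_
  rw [hj]
  have h2 : Real.exp (k * ‖t‖) * Real.exp (‖expForm z‖ * ‖t‖) ≤
      Real.exp (N * ‖x‖) * Real.exp (N * ‖t - x‖) := by
    rw [← Real.exp_add, ← Real.exp_add, Real.exp_le_exp]
    have h3 : ‖t‖ ≤ ‖x‖ + ‖t - x‖ := by
      simpa using norm_add_le x (t - x)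
    have h4 : (0 : ℝ) ≤ N := Nat.cast_nonneg N
    nlinarith [norm_nonneg t]
  have h5 := hC i t
  have h6 := hD (j - i) (t - x)
  set a := ‖iteratedFDeriv ℝ i (fun t : RSpace n => Complex.exp (expForm z t)) t‖ with ha
  set b := ‖iteratedFDeriv ℝ (j - i) ψ (t - x)‖ with hb
  have hb0 : 0 ≤ b := norm_nonneg _
  have hCi := hC0 i
  calc Real.exp (k * ‖t‖) * ((j.choose i : ℝ) * a * b)
      ≤ Real.exp (k * ‖t‖) *
          ((j.choose i : ℝ) * (C i * Real.exp (‖expForm z‖ * ‖t‖)) * b) := by gcongr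
    _ = (j.choose i : ℝ) * C i *
          (Real.exp (k * ‖t‖) * Real.exp (‖expForm z‖ * ‖t‖)) * b := by ring
    _ ≤ (j.choose i : ℝ) * C i * (Real.exp (N * ‖x‖) * Real.exp (N * ‖t - x‖)) * b := by gcongr
    _ = (j.choose i : ℝ) * C i * (Real.exp (N * ‖x‖) * (Real.exp (N * ‖t - x‖) * b)) := by ring
    _ ≤ _ := by gcongr

theorem norm_exp_real_cdot {n : ℕ} (ξ t : RSpace n) :
    ‖Complex.exp (-2 * Real.pi * Complex.I * cdot (fun j => (ξ j : ℂ)) t)‖ = 1 := by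
  have h : -2 * Real.pi * Complex.I * cdot (fun j => (ξ j : ℂ)) t =
      ((-2 * Real.pi * ∑ j, ξ j * t j : ℝ) : ℂ) * Complex.I := by
    simp only [cdot]; push_cast; ring
  rw [h, Complex.norm_exp_ofReal_mul_I]

theorem norm_fourier_timeFreqFun {n : ℕ} (φ : RSpace n → ℂ) (x ξ τ : RSpace n) :
    ‖𝓕 (timeFreqFun φ x (fun j => (ξ j : ℂ))) τ‖ = ‖𝓕 φ (-(τ + ξ))‖ := by
  have hc : ∀ t : RSpace n, cdot (fun j => (ξ j : ℂ)) t = ((inner ℝ t ξ : ℝ) : ℂ) := by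
    intro t
    simp [cdot, PiLp.inner_apply]
  rw [Real.fourier_eq', Real.fourier_eq']
  have h1 := integral_add_right_eq_self (μ := (volume : Measure (RSpace n)))
    (fun t : RSpace n => Complex.exp (((-2 * Real.pi * inner ℝ t τ : ℝ) : ℂ) * Complex.I) •
      timeFreqFun φ x (fun j => (ξ j : ℂ)) t) x
  rw [← h1]
  have h2 : ∀ t : RSpace n,
      Complex.exp (((-2 * Real.pi * inner ℝ (t + x) τ : ℝ) : ℂ) * Complex.I) •
        timeFreqFun φ x (fun j => (ξ j : ℂ)) (t + x) =
      Complex.exp (((-2 * Real.pi * inner ℝ x (τ + ξ) : ℝ) : ℂ) * Complex.I) *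
        conj (Complex.exp (((-2 * Real.pi * inner ℝ t (-(τ + ξ)) : ℝ) : ℂ) * Complex.I) • φ t) := by
    intro t
    simp only [timeFreqFun, hc, smul_eq_mul, map_mul, ← Complex.exp_conj, Complex.conj_ofReal,
      Complex.conj_I, add_sub_cancel_right, ← mul_assoc, ← Complex.exp_add]
    congr 2
    simp only [inner_add_left, inner_add_right, inner_neg_right]
    push_cast
    ring
  simp only [h2]
  rw [integral_const_mul, integral_conj, norm_mul, Complex.norm_exp_ofReal_mul_I, one_mul,
    RCLike.norm_conj]

theorem timeFreqFun_mem_gelfandShilov {n : ℕ} {φ : RSpace n → ℂ}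
    (hφ : φ ∈ gelfandShilovSubmodule n) (x ξ : RSpace n) :
    timeFreqFun φ x (fun j => (ξ j : ℂ)) ∈ gelfandShilovSubmodule n := by
  obtain ⟨⟨Φ, hΦ, hΦ'⟩, h1, h2⟩ := hφ
  refine ⟨⟨fun w => Complex.exp (-2 * Real.pi * Complex.I * ∑ j, (ξ j : ℂ) * w j) *
      star (Φ (star w - fun j => (x j : ℂ))), ?_, ?_⟩, fun k => ?_, fun k => ?_⟩
  · have h3 : Differentiable ℂ (fun w : Fin n → ℂ => Φ (w - fun j => (x j : ℂ))) :=
      hΦ.comp (differentiable_id.sub_const _)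
    have h4 : Differentiable ℂ
        (fun w : Fin n → ℂ => star (Φ (star w - fun j => (x j : ℂ)))) := by
      intro w
      have h5 := (h3 (star w)).star_star
      rw [star_star] at h5
      exact h5
    exact Differentiable.mul (by fun_prop) h4
  · intro t
    simp only [timeFreqFun, cdot]
    congr 2
    rw [← hΦ']
    congr 1
    funext j
    simp
  · obtain ⟨C, hC⟩ := h1 k
    refine ⟨Real.exp (k * ‖x‖) * C, fun t => ?_⟩
    have h3 : ‖timeFreqFun φ x (fun j => (ξ j : ℂ)) t‖ = ‖φ (t - x)‖ := by
      rw [timeFreqFun, norm_mul, norm_exp_real_cdot, one_mul, RCLike.norm_conj]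
    have h4 : Real.exp (k * ‖t‖) ≤ Real.exp (k * ‖x‖) * Real.exp (k * ‖t - x‖) := by
      rw [← Real.exp_add, ← mul_add]
      have : ‖t‖ ≤ ‖x‖ + ‖t - x‖ := by simpa using norm_add_le x (t - x)
      gcongr
    rw [h3]
    calc _ ≤ Real.exp (k * ‖x‖) * Real.exp (k * ‖t - x‖) * ‖φ (t - x)‖ := by gcongr
      _ = Real.exp (k * ‖x‖) * (Real.exp (k * ‖t - x‖) * ‖φ (t - x)‖) := by ring
      _ ≤ _ := by gcongr; exact hC _
  · obtain ⟨C, hC⟩ := h2 k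
    refine ⟨Real.exp (k * ‖ξ‖) * C, fun τ => ?_⟩
    have h4 : Real.exp (k * ‖τ‖) ≤ Real.exp (k * ‖ξ‖) * Real.exp (k * ‖-(τ + ξ)‖) := by
      rw [← Real.exp_add, ← mul_add, norm_neg]
      have : ‖τ‖ ≤ ‖ξ‖ + ‖τ + ξ‖ := by
        have := norm_sub_le (τ + ξ) ξ
        rw [add_sub_cancel_right] at this
        linarith
      gcongr
    rw [norm_fourier_timeFreqFun]
    calc _ ≤ Real.exp (k * ‖ξ‖) * Real.exp (k * ‖-(τ + ξ)‖) * ‖𝓕 φ (-(τ + ξ))‖ := by gcongr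
      _ = Real.exp (k * ‖ξ‖) * (Real.exp (k * ‖-(τ + ξ)‖) * ‖𝓕 φ (-(τ + ξ))‖) := by ring
      _ ≤ _ := by gcongr; exact hC _

/-- For `F ∈ 𝒦₁'(ℝⁿ)`, `ψ ∈ 𝒦₁(ℝⁿ)`, `x ∈ ℝⁿ` and `z ∈ ℂⁿ`, the short-time Fourier transform
`V_ψ F(x, z) = ⟨F(t), e^{-2π i z·t} conj (ψ (t - x))⟩`. -/
def stft {n : ℕ} (ψ : K1 n) (F : K1Dual n) (x : RSpace n) (z : Fin n → ℂ) : ℂ :=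
  F ⟨timeFreqFun ψ x z, timeFreqFun_mem_k1 ψ.2 x z⟩

/-- For `f ∈ (Σ₁¹)'(ℝⁿ)`, `φ ∈ Σ₁¹(ℝⁿ)` and `x, ξ ∈ ℝⁿ`, the short-time Fourier transform
`V_φ f(x, ξ) = ⟨f(t), e^{-2π i ξ·t} conj (φ (t - x))⟩`. -/
def stftGS {n : ℕ} (φ : GelfandShilov n) (f : GelfandShilovDual n) (x ξ : RSpace n) : ℂ :=
  f ⟨timeFreqFun φ x (fun j => (ξ j : ℂ)), timeFreqFun_mem_gelfandShilov φ.2 x ξ⟩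

/-! ### Weights, mixed norms and modulation spaces -/

/-- The weight class `𝔐₁`: positive, measurable, locally bounded functions `m` on `ℝ²ⁿ` with
`m(x₁ + x₂, ξ₁ + ξ₂) / m(x₁, ξ₁) ≤ A e^{a|x₂|} (1 + |ξ₂|)^s` for some `A > 0` and `a, s ≥ 0`. -/
structure IsWeightM1 {n : ℕ} (m : RSpace n × RSpace n → ℝ) : Prop where
  pos : ∀ y, 0 < m y
  measurable : Measurable m
  locally_bounded : ∀ K : Set (RSpace n × RSpace n), IsCompact K → BddAbove (m '' K)
  moderate : ∃ A a s : ℝ, 0 < A ∧ 0 ≤ a ∧ 0 ≤ s ∧ ∀ x₁ ξ₁ x₂ ξ₂ : RSpace n,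
    m (x₁ + x₂, ξ₁ + ξ₂) / m (x₁, ξ₁) ≤ A * Real.exp (a * ‖x₂‖) * (1 + ‖ξ₂‖) ^ s

/-- The norm of `L^{p,q}_m(ℝ²ⁿ)`: the `L^q` norm in `ξ` of the `L^p` norm in `x` of
`F(x, ξ) m(x, ξ)`, with value `∞` allowed. -/
def mixedNorm {n : ℕ} (p q : ℝ≥0∞) (m : RSpace n × RSpace n → ℝ)
    (F : RSpace n → RSpace n → ℂ) : ℝ≥0∞ :=
  eLpNorm (fun ξ => eLpNorm (fun x => F x ξ * (m (x, ξ) : ℂ)) p volume) q volume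

/-- The norm `‖f‖_{M^{p,q}_m} = ‖V_φ f‖_{L^{p,q}_m}` of `f ∈ (Σ₁¹)'(ℝⁿ)` with respect to the
window `φ ∈ Σ₁¹(ℝⁿ)`. -/
def modulationNorm {n : ℕ} (φ : GelfandShilov n) (p q : ℝ≥0∞) (m : RSpace n × RSpace n → ℝ)
    (f : GelfandShilovDual n) : ℝ≥0∞ :=
  mixedNorm p q m (stftGS φ f)

/-- The modulation space `M^{p,q}_m(ℝⁿ)`, described through the window `φ ∈ Σ₁¹(ℝⁿ)`. -/
def modulationSpace {n : ℕ} (φ : GelfandShilov n) (p q : ℝ≥0∞) (m : RSpace n × RSpace n → ℝ) :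
    Set (GelfandShilovDual n) :=
  {f | modulationNorm φ p q m f < ⊤}

/-- The same norm for `F ∈ 𝒦₁'(ℝⁿ)` with respect to a window `γ ∈ 𝒦₁(ℝⁿ)`. -/
def modulationNormK1 {n : ℕ} (γ : K1 n) (p q : ℝ≥0∞) (m : RSpace n × RSpace n → ℝ)
    (F : K1Dual n) : ℝ≥0∞ :=
  mixedNorm p q m (fun x ξ => stft γ F x (fun j => (ξ j : ℂ)))

/-- `F ∈ 𝒦₁'(ℝⁿ)` and `f ∈ (Σ₁¹)'(ℝⁿ)` agree on `Σ₁¹(ℝⁿ) ⊆ 𝒦₁(ℝⁿ)`. -/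
def Extends {n : ℕ} (F : K1Dual n) (f : GelfandShilovDual n) : Prop :=
  ∀ (χ : K1 n) (φ : GelfandShilov n), (∀ t, χ t = φ t) → F χ = f φ

end

/-!
For a window `g` with `κ = ∫ |g|² ≠ 0`, Fourier inversion gives the reproducing formula
`κ F(χ) = ∫∫ c_χ(y, w) V_g F(y, w) dy dw`, where the Gabor coefficient `c_χ(y, w)` of a test
function `χ` is itself a short-time Fourier transform. The formula holds for all continuous
functionals `F` on `𝒦₁` and on `Σ₁¹`.

The Gabor coefficients of `χ ∈ 𝒦₁` decay faster than every power of `e^{|y|} (1 + |w|)`, with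
constants that are seminorms of `χ`, so they absorb a weight of class `𝔐₁`. Three consequences
follow. For `f ∈ M^{p,q}_m` the integral with `V_φ f` converges for all `χ ∈ 𝒦₁` and defines the
extension of `f`. Since it determines `F(χ)` from `V_φ F = V_φ f`, the extension is unique. Applied
to time-frequency shifts of a window `χ`, the formula bounds `|V_χ F| m` by an average of translates
of `|V_g F| m` against a finite measure whose mass is controlled by a seminorm of `χ`; Minkowski's
inequality then bounds the norm of `V_χ F` in `L^{p,q}_m` by that of `V_g F`.

Finally, `e^{-2π x·η} V_ψ F(x, ξ + iη) = V_{ψ_η} F(x, ξ)` for the window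
`ψ_η(t) = e^{2π t·η} ψ(t)`, and the seminorms of `ψ_η` are bounded uniformly for `|η| ≤ λ`, which
reduces the estimate on the strip to the one at real frequencies.
-/

noncomputable section

/-! ### Submultiplicative weights and rapid decay -/

/-- Continuous, even, submultiplicative weights dominating `1 + ‖t‖`. Rapid decay with respect to
`e^‖t‖` gives the seminorms of `𝒦₁` and `Σ₁¹`; rapid decay with respect to `1 + ‖t‖` is what
smoothness provides on the Fourier side. -/
structure IsBaseWeight {E : Type*} [NormedAddCommGroup E] (ρ : E → ℝ) : Prop where
  continuous : Continuous ρ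
  one_add_norm_le : ∀ t, 1 + ‖t‖ ≤ ρ t
  neg : ∀ t, ρ (-t) = ρ t
  add_le_mul : ∀ s t, ρ (s + t) ≤ ρ s * ρ t

/-- Continuous functions that decay faster than every power of the weight `ρ`. -/
structure Rapid {E : Type*} [NormedAddCommGroup E] (ρ : E → ℝ) (f : E → ℂ) : Prop where
  continuous : Continuous f
  decay : ∀ k : ℕ, ∃ C : ℝ, ∀ t, ρ t ^ k * ‖f t‖ ≤ C

section Weights

variable {E : Type*} [NormedAddCommGroup E] {ρ : E → ℝ}

theorem isBaseWeight_exp_norm : IsBaseWeight fun t : E => Real.exp ‖t‖ where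
  continuous := by fun_prop
  one_add_norm_le t := by linarith [Real.add_one_le_exp ‖t‖]
  neg t := by simp
  add_le_mul s t := by
    rw [← Real.exp_add]
    exact Real.exp_le_exp.2 (norm_add_le s t)

theorem isBaseWeight_one_add_norm : IsBaseWeight fun t : E => 1 + ‖t‖ where
  continuous := by fun_prop
  one_add_norm_le t := le_rfl
  neg t := by simp
  add_le_mul s t := by nlinarith [norm_add_le s t, norm_nonneg s, norm_nonneg t]

namespace IsBaseWeight

theorem one_le (hρ : IsBaseWeight ρ) (t : E) : 1 ≤ ρ t := by
  linarith [hρ.one_add_norm_le t, norm_nonneg t]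

theorem pos (hρ : IsBaseWeight ρ) (t : E) : 0 < ρ t := zero_lt_one.trans_le (hρ.one_le t)

theorem pow_pos (hρ : IsBaseWeight ρ) (k : ℕ) (t : E) : 0 < ρ t ^ k := _root_.pow_pos (hρ.pos t) k

theorem pow_add_le_mul (hρ : IsBaseWeight ρ) (k : ℕ) (s t : E) :
    ρ (s + t) ^ k ≤ ρ s ^ k * ρ t ^ k := by
  rw [← mul_pow]
  exact pow_le_pow_left₀ (hρ.pos _).le (hρ.add_le_mul s t) k

theorem pow_le_mul_pow_sub (hρ : IsBaseWeight ρ) (k : ℕ) (x t : E) :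
    ρ t ^ k ≤ ρ x ^ k * ρ (t - x) ^ k := by
  simpa using hρ.pow_add_le_mul k x (t - x)

theorem pow_le_mul_pow_sub_rev (hρ : IsBaseWeight ρ) (k : ℕ) (x t : E) :
    ρ x ^ k ≤ ρ t ^ k * ρ (t - x) ^ k := by
  simpa [← hρ.neg (x - t)] using hρ.pow_le_mul_pow_sub k t x

theorem pow_mul_norm_comp_sub_le (hρ : IsBaseWeight ρ) {f : E → ℂ} {k : ℕ} {A : ℝ}
    (hA : ∀ t, ρ t ^ k * ‖f t‖ ≤ A) (x t : E) : ρ t ^ k * ‖f (t - x)‖ ≤ ρ x ^ k * A := by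
  have hx := hρ.pow_pos k x
  calc ρ t ^ k * ‖f (t - x)‖ ≤ ρ x ^ k * ρ (t - x) ^ k * ‖f (t - x)‖ := by
        gcongr
        exact hρ.pow_le_mul_pow_sub k x t
    _ = ρ x ^ k * (ρ (t - x) ^ k * ‖f (t - x)‖) := by ring
    _ ≤ ρ x ^ k * A := by gcongr; exact hA _

variable [NormedSpace ℝ E] [FiniteDimensional ℝ E] [MeasurableSpace E] [BorelSpace E]
  {μ : Measure E} [μ.IsAddHaarMeasure]

theorem integrable_inv_pow (hρ : IsBaseWeight ρ) :
    Integrable (fun t => (ρ t ^ (Module.finrank ℝ E + 1))⁻¹) μ := by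
  have h_one_add : Integrable
      (fun t : E => (1 + ‖t‖) ^ (-((Module.finrank ℝ E + 1 : ℕ) : ℝ))) μ :=
    integrable_one_add_norm (by simp)
  refine h_one_add.mono' ?_ (.of_forall fun t => ?_)
  · exact ((hρ.continuous.pow _).inv₀ fun t => (hρ.pow_pos _ t).ne').aestronglyMeasurable
  · rw [Real.norm_of_nonneg (inv_nonneg.2 (hρ.pow_pos _ t).le), Real.rpow_neg (by positivity),
      Real.rpow_natCast]
    gcongr
    exact hρ.one_add_norm_le t

end IsBaseWeight

namespace Rapid

variable {f : E → ℂ}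

theorem exists_norm_le (hf : Rapid ρ f) : ∃ C : ℝ, ∀ t, ‖f t‖ ≤ C := by
  simpa using hf.decay 0

theorem comp_neg (hf : Rapid ρ f) (hρ : IsBaseWeight ρ) : Rapid ρ fun t => f (-t) := by
  refine ⟨hf.continuous.comp continuous_neg, fun k => ?_⟩
  obtain ⟨C, hC⟩ := hf.decay k
  exact ⟨C, fun t => hρ.neg t ▸ hC (-t)⟩

theorem conj_comp_sub (hf : Rapid ρ f) (hρ : IsBaseWeight ρ) (x : E) :
    Rapid ρ fun t => conj (f (t - x)) := by
  refine ⟨Complex.continuous_conj.comp (hf.continuous.comp (by fun_prop)), fun k => ?_⟩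
  obtain ⟨C, hC⟩ := hf.decay k
  refine ⟨ρ x ^ k * C, fun t => ?_⟩
  rw [RCLike.norm_conj]
  exact hρ.pow_mul_norm_comp_sub_le hC x t

variable [NormedSpace ℝ E] [FiniteDimensional ℝ E] [MeasurableSpace E] [BorelSpace E]
  {μ : Measure E} [μ.IsAddHaarMeasure]

theorem integrable_pow_mul (hf : Rapid ρ f) (hρ : IsBaseWeight ρ) (k : ℕ) :
    Integrable (fun t => ρ t ^ k * ‖f t‖) μ := by
  obtain ⟨C, hC⟩ := hf.decay (Module.finrank ℝ E + 1 + k)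
  refine (hρ.integrable_inv_pow.const_mul C).mono' ?_ (.of_forall fun t => ?_)
  · exact ((hρ.continuous.pow k).mul hf.continuous.norm).aestronglyMeasurable
  · rw [Real.norm_of_nonneg (mul_nonneg (hρ.pow_pos k t).le (norm_nonneg _)), ← div_eq_mul_inv,
      le_div_iff₀ (hρ.pow_pos _ t), mul_right_comm, ← pow_add, add_comm k]
    exact hC t

theorem integrable (hf : Rapid ρ f) (hρ : IsBaseWeight ρ) : Integrable f μ :=
  (integrable_norm_iff hf.continuous.aestronglyMeasurable).1 <| by
    simpa using hf.integrable_pow_mul hρ 0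

end Rapid

end Weights

section Fourier

variable {E : Type*} [NormedAddCommGroup E] [InnerProductSpace ℝ E] [FiniteDimensional ℝ E]
  [MeasurableSpace E] [BorelSpace E]

theorem continuous_fourier_of_integrable {f : E → ℂ} (hf : Integrable f) : Continuous (𝓕 f) :=
  VectorFourier.fourierIntegral_continuous Real.continuous_fourierChar continuous_inner hf

theorem conj_fourierChar_smul (a : ℝ) (z : ℂ) : conj (𝐞 a • z) = 𝐞 (-a) • conj z := by
  simp [Circle.smul_def, AddChar.map_neg_eq_inv]

theorem conj_fourierInv (f : E → ℂ) (t : E) : conj (𝓕⁻ f t) = 𝓕 (fun τ => conj (f τ)) t := by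
  rw [Real.fourierInv_eq, Real.fourier_eq, ← integral_conj]
  simp only [conj_fourierChar_smul]

theorem integral_mul_conj_fourier {f g : E → ℂ} (hf : Integrable f) (hg : Integrable g)
    (hgc : Continuous g) (hg' : Integrable (𝓕 g)) :
    ∫ s, f s * conj (g s) = ∫ τ, 𝓕 f τ * conj (𝓕 g τ) := by
  have h_conj (s : E) : conj (g s) = 𝓕 (fun τ => conj (𝓕 g τ)) s := by
    rw [← conj_fourierInv, hgc.fourierInv_fourier_eq hg hg']
  have h_swap := VectorFourier.integral_fourierIntegral_smul_eq_flip (L := innerₗ E)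
    (μ := volume) (ν := volume) Real.continuous_fourierChar continuous_inner hf
    (g := fun τ => conj (𝓕 g τ)) (Complex.conjCLE.integrable_comp_iff.2 hg')
  rw [flip_innerₗ] at h_swap
  simp only [smul_eq_mul] at h_swap
  simp only [h_conj]
  exact h_swap.symm

end Fourier

/-! ### Gabor atoms and Gabor coefficients -/

section GaborAtom

variable {E : Type*} [NormedAddCommGroup E] [InnerProductSpace ℝ E]

/-- The Gabor atom `conj (M_w T_y φ)`, that is `t ↦ e^{-2πi ⟨t, w⟩} conj (φ (t - y))`, at
`p = (y, w)`. The conjugation is built in, so that the bilinear pairing with the atom is the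
short-time Fourier transform. -/
def gaborAtom (φ : E → ℂ) (p : E × E) (t : E) : ℂ := 𝐞 (-inner ℝ t p.2) • conj (φ (t - p.1))

theorem norm_gaborAtom (φ : E → ℂ) (p : E × E) (t : E) : ‖gaborAtom φ p t‖ = ‖φ (t - p.1)‖ := by
  rw [gaborAtom, Circle.norm_smul, RCLike.norm_conj]

theorem continuous_uncurry_gaborAtom {φ : E → ℂ} (hφ : Continuous φ) :
    Continuous fun p : (E × E) × E => gaborAtom φ p.1 p.2 := by
  unfold gaborAtom
  exact (Real.continuous_fourierChar.comp (by fun_prop)).smul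
    (Complex.continuous_conj.comp (hφ.comp (by fun_prop)))

theorem continuous_gaborAtom {φ : E → ℂ} (hφ : Continuous φ) (p : E × E) :
    Continuous (gaborAtom φ p) :=
  (continuous_uncurry_gaborAtom hφ).comp (Continuous.prodMk_right p)

theorem continuous_gaborAtom_left {φ : E → ℂ} (hφ : Continuous φ) (t : E) :
    Continuous fun p => gaborAtom φ p t :=
  (continuous_uncurry_gaborAtom hφ).comp (Continuous.prodMk_left t)

theorem Rapid.gaborAtom {ρ : E → ℝ} {φ : E → ℂ} (hφ : Rapid ρ φ) (hρ : IsBaseWeight ρ)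
    (p : E × E) : Rapid ρ (gaborAtom φ p) := by
  refine ⟨continuous_gaborAtom hφ.continuous p, fun k => ?_⟩
  simpa only [norm_gaborAtom, RCLike.norm_conj] using (hφ.conj_comp_sub hρ p.1).decay k

end GaborAtom

section GaborCoeff

variable {E : Type*} [NormedAddCommGroup E] [InnerProductSpace ℝ E] [FiniteDimensional ℝ E]
  [MeasurableSpace E] [BorelSpace E]

/-- Functions that decay rapidly with respect to `ρ` and whose Fourier transform decays rapidly
with respect to `σ`. -/
structure BiRapid (ρ σ : E → ℝ) (f : E → ℂ) : Prop where
  fst : Rapid ρ f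
  snd : Rapid σ (𝓕 f)

/-- The coefficient `∫ χ(s) e^{2πi ⟨s, w⟩} φ(s - y) ds` at `p = (y, w)` in the expansion of `χ` into
the atoms `gaborAtom φ p`. -/
def gaborCoeff (φ χ : E → ℂ) (p : E × E) : ℂ := ∫ s, χ s * conj (gaborAtom φ p s)

variable {ρ σ : E → ℝ} {φ χ : E → ℂ} {k : ℕ} {A B : ℝ}

theorem fourier_gaborAtom (φ : E → ℂ) (p : E × E) (τ : E) :
    𝓕 (gaborAtom φ p) τ = 𝐞 (-inner ℝ p.1 (τ + p.2)) • conj (𝓕 φ (-(τ + p.2))) := by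
  rw [Real.fourier_eq, Real.fourier_eq, ← integral_conj, Circle.smul_def, ← integral_smul,
    ← integral_add_right_eq_self _ p.1]
  congr 1 with t
  simp only [← Circle.smul_def, gaborAtom, conj_fourierChar_smul, add_sub_cancel_right, smul_smul,
    ← AddChar.map_add_eq_mul, inner_add_left, inner_add_right, inner_neg_right]
  ring_nf

theorem norm_fourier_gaborAtom (φ : E → ℂ) (p : E × E) (τ : E) :
    ‖𝓕 (gaborAtom φ p) τ‖ = ‖𝓕 φ (-(τ + p.2))‖ := by
  rw [fourier_gaborAtom, Circle.norm_smul, RCLike.norm_conj]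

theorem BiRapid.gaborAtom (hφ : BiRapid ρ σ φ) (hρ : IsBaseWeight ρ) (hσ : IsBaseWeight σ)
    (p : E × E) : BiRapid ρ σ (gaborAtom φ p) := by
  have h_atom := hφ.fst.gaborAtom hρ p
  refine ⟨h_atom, continuous_fourier_of_integrable (h_atom.integrable hρ), fun k => ?_⟩
  obtain ⟨C, hC⟩ := ((hφ.snd.comp_neg hσ).conj_comp_sub hσ (-p.2)).decay k
  refine ⟨C, fun τ => ?_⟩
  simpa only [norm_fourier_gaborAtom, RCLike.norm_conj, sub_neg_eq_add] using hC τ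

theorem gaborCoeff_eq_fourierInv (φ χ : E → ℂ) (y w : E) :
    gaborCoeff φ χ (y, w) = 𝓕⁻ (fun s => χ s * φ (s - y)) w := by
  rw [gaborCoeff, Real.fourierInv_eq]
  congr 1 with s
  rw [gaborAtom, conj_fourierChar_smul, Complex.conj_conj, neg_neg, mul_smul_comm]

theorem pow_mul_norm_integral_mul_conj_le {f g h : E → ℂ} (hρ : IsBaseWeight ρ) (hg : Rapid ρ g)
    (hA : ∀ t, ρ t ^ k * ‖f t‖ ≤ A) {x : E} (hh : ∀ t, ‖h t‖ = ‖g (t - x)‖) :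
    ρ x ^ k * ‖∫ t, f t * conj (h t)‖ ≤ A * ∫ t, ρ t ^ k * ‖g t‖ := by
  have hi := (hg.integrable_pow_mul (μ := volume) hρ k).const_mul A
  have hx := hρ.pow_pos k x
  rw [← integral_const_mul, ← integral_sub_right_eq_self (fun t => A * (ρ t ^ k * ‖g t‖)) x,
    ← Real.norm_of_nonneg hx.le, ← norm_smul, ← integral_smul]
  refine norm_integral_le_of_norm_le (hi.comp_sub_right x) (.of_forall fun t => ?_)
  have ht := hρ.pow_pos k (t - x)
  rw [norm_smul, norm_mul, RCLike.norm_conj, hh, Real.norm_of_nonneg hx.le]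
  calc ρ x ^ k * (‖f t‖ * ‖g (t - x)‖)
      ≤ ρ t ^ k * ρ (t - x) ^ k * (‖f t‖ * ‖g (t - x)‖) := by
        gcongr
        exact hρ.pow_le_mul_pow_sub_rev k x t
    _ = ρ t ^ k * ‖f t‖ * (ρ (t - x) ^ k * ‖g (t - x)‖) := by ring
    _ ≤ A * (ρ (t - x) ^ k * ‖g (t - x)‖) := by gcongr; exact hA t

theorem pow_mul_norm_gaborCoeff_le_time (hρ : IsBaseWeight ρ) (hφ : Rapid ρ φ)
    (hA : ∀ t, ρ t ^ k * ‖χ t‖ ≤ A) (p : E × E) :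
    ρ p.1 ^ k * ‖gaborCoeff φ χ p‖ ≤ A * ∫ s, ρ s ^ k * ‖φ s‖ :=
  pow_mul_norm_integral_mul_conj_le hρ hφ hA (norm_gaborAtom φ p)

theorem pow_mul_norm_gaborCoeff_le_freq (hρ : IsBaseWeight ρ) (hσ : IsBaseWeight σ)
    (hφ : BiRapid ρ σ φ) (hχ : Integrable χ) (hB : ∀ ξ, σ ξ ^ k * ‖𝓕 χ ξ‖ ≤ B) (p : E × E) :
    σ p.2 ^ k * ‖gaborCoeff φ χ p‖ ≤ B * ∫ s, σ s ^ k * ‖𝓕 φ s‖ := by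
  have h_atom := hφ.gaborAtom hρ hσ p
  have h_le := pow_mul_norm_integral_mul_conj_le hσ (hφ.snd.comp_neg hσ) hB (x := -p.2)
    (h := 𝓕 (gaborAtom φ p)) fun τ => by rw [norm_fourier_gaborAtom, sub_neg_eq_add]
  rw [← integral_neg_eq_self fun s => σ s ^ k * ‖𝓕 φ s‖]
  rwa [← integral_mul_conj_fourier hχ (h_atom.fst.integrable hρ) h_atom.fst.continuous
    (h_atom.snd.integrable hσ), hσ.neg, ← funext fun s => congrArg (· ^ k * ‖𝓕 φ (-s)‖) (hσ.neg s)]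
    at h_le

theorem pow_mul_pow_mul_norm_gaborCoeff_le (hρ : IsBaseWeight ρ) (hσ : IsBaseWeight σ)
    (hφ : BiRapid ρ σ φ) (hχ : Integrable χ) (hA : ∀ t, ρ t ^ (2 * k) * ‖χ t‖ ≤ A)
    (hB : ∀ ξ, σ ξ ^ (2 * k) * ‖𝓕 χ ξ‖ ≤ B) (p : E × E) :
    ρ p.1 ^ k * σ p.2 ^ k * ‖gaborCoeff φ χ p‖ ≤
      A * (∫ s, ρ s ^ (2 * k) * ‖φ s‖) + B * ∫ s, σ s ^ (2 * k) * ‖𝓕 φ s‖ := by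
  have h_prod : ρ p.1 ^ k * σ p.2 ^ k ≤ ρ p.1 ^ (2 * k) + σ p.2 ^ (2 * k) := by
    rw [mul_comm 2 k, pow_mul, pow_mul]
    nlinarith [sq_nonneg (ρ p.1 ^ k - σ p.2 ^ k), sq_nonneg (ρ p.1 ^ k), sq_nonneg (σ p.2 ^ k)]
  calc ρ p.1 ^ k * σ p.2 ^ k * ‖gaborCoeff φ χ p‖
      ≤ (ρ p.1 ^ (2 * k) + σ p.2 ^ (2 * k)) * ‖gaborCoeff φ χ p‖ := by gcongr
    _ = ρ p.1 ^ (2 * k) * ‖gaborCoeff φ χ p‖ + σ p.2 ^ (2 * k) * ‖gaborCoeff φ χ p‖ := by ring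
    _ ≤ _ := add_le_add (pow_mul_norm_gaborCoeff_le_time hρ hφ.fst hA p)
      (pow_mul_norm_gaborCoeff_le_freq hρ hσ hφ hχ hB p)

theorem continuous_gaborCoeff (hφ : Rapid ρ φ) (hχ : Integrable χ) :
    Continuous (gaborCoeff φ χ) := by
  obtain ⟨C, hC⟩ := hφ.exists_norm_le
  refine continuous_of_dominated (bound := fun s => ‖χ s‖ * C) (fun p => ?_)
    (fun p => .of_forall fun s => ?_) (hχ.norm.mul_const C) (.of_forall fun s => ?_)
  · exact hχ.aestronglyMeasurable.mul (Complex.continuous_conj.comp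
      (continuous_gaborAtom hφ.continuous p)).aestronglyMeasurable
  · rw [norm_mul, RCLike.norm_conj, norm_gaborAtom]
    gcongr
    exact hC _
  · exact continuous_const.mul
      (Complex.continuous_conj.comp (continuous_gaborAtom_left hφ.continuous s))

theorem integrable_pow_mul_pow_mul_norm_gaborCoeff (hρ : IsBaseWeight ρ) (hσ : IsBaseWeight σ)
    (hφ : BiRapid ρ σ φ) (hχ : BiRapid ρ σ χ) (k : ℕ) :
    Integrable fun p : E × E => ρ p.1 ^ k * σ p.2 ^ k * ‖gaborCoeff φ χ p‖ := by
  set N := Module.finrank ℝ E + 1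
  obtain ⟨A, hA⟩ := hχ.fst.decay (2 * (N + k))
  obtain ⟨B, hB⟩ := hχ.snd.decay (2 * (N + k))
  have hχi : Integrable χ := hχ.fst.integrable hρ
  obtain ⟨D, hD⟩ : ∃ D, ∀ p : E × E,
      ρ p.1 ^ (N + k) * σ p.2 ^ (N + k) * ‖gaborCoeff φ χ p‖ ≤ D :=
    ⟨_, pow_mul_pow_mul_norm_gaborCoeff_le hρ hσ hφ hχi hA hB⟩
  refine ((hρ.integrable_inv_pow.mul_prod hσ.integrable_inv_pow).const_mul D).mono' ?_
    (.of_forall fun p => ?_)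
  · exact ((((hρ.continuous.comp continuous_fst).pow k).mul
      ((hσ.continuous.comp continuous_snd).pow k)).mul
      (continuous_gaborCoeff hφ.fst hχi).norm).aestronglyMeasurable
  · have h1 := hρ.pow_pos k p.1
    have h2 := hσ.pow_pos k p.2
    have h3 := hρ.pow_pos N p.1
    have h4 := hσ.pow_pos N p.2
    rw [Real.norm_of_nonneg (by positivity), ← mul_inv, ← div_eq_mul_inv,
      le_div_iff₀ (by positivity)]
    calc _ = ρ p.1 ^ (N + k) * σ p.2 ^ (N + k) * ‖gaborCoeff φ χ p‖ := by ring
      _ ≤ D := hD p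

theorem integrable_gaborCoeff (hρ : IsBaseWeight ρ) (hσ : IsBaseWeight σ)
    (hφ : BiRapid ρ σ φ) (hχ : BiRapid ρ σ χ) : Integrable (gaborCoeff φ χ) :=
  (integrable_norm_iff (continuous_gaborCoeff hφ.fst
    (hχ.fst.integrable hρ)).aestronglyMeasurable).1 <| by
    simpa using integrable_pow_mul_pow_mul_norm_gaborCoeff hρ hσ hφ hχ 0

theorem integrable_gaborCoeff_right (hρ : IsBaseWeight ρ) (hσ : IsBaseWeight σ)
    (hφ : BiRapid ρ σ φ) (hχ : BiRapid ρ σ χ) (y : E) :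
    Integrable fun w => gaborCoeff φ χ (y, w) := by
  have hχi : Integrable χ := hχ.fst.integrable hρ
  obtain ⟨B, hB⟩ := hχ.snd.decay (Module.finrank ℝ E + 1)
  refine (hσ.integrable_inv_pow.const_mul
    (B * ∫ s, σ s ^ (Module.finrank ℝ E + 1) * ‖𝓕 φ s‖)).mono' ?_ (.of_forall fun w => ?_)
  · exact ((continuous_gaborCoeff hφ.fst hχi).comp
      (Continuous.prodMk_right y)).aestronglyMeasurable
  · rw [← div_eq_mul_inv, le_div_iff₀ (hσ.pow_pos _ w), mul_comm]
    exact pow_mul_norm_gaborCoeff_le_freq hρ hσ hφ hχi hB (y, w)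

end GaborCoeff

/-! ### The reproducing formula -/

section PointwiseReproducing

variable {E : Type*} [NormedAddCommGroup E] [InnerProductSpace ℝ E] [FiniteDimensional ℝ E]
  [MeasurableSpace E] [BorelSpace E] {ρ σ : E → ℝ} {φ χ : E → ℂ}

theorem integral_gaborCoeff_mul_gaborAtom_right (hρ : IsBaseWeight ρ) (hσ : IsBaseWeight σ)
    (hφ : BiRapid ρ σ φ) (hχ : BiRapid ρ σ χ) (t y : E) :
    ∫ w, gaborCoeff φ χ (y, w) * gaborAtom φ (y, w) t = χ t * (φ (t - y) * conj (φ (t - y))) := by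
  obtain ⟨C, hC⟩ := hφ.fst.exists_norm_le
  have hc : Continuous fun s => φ (s - y) := hφ.fst.continuous.comp (by fun_prop)
  have hi : Integrable fun s => χ s * φ (s - y) :=
    (hχ.fst.integrable hρ).mul_bdd (c := C) hc.aestronglyMeasurable (.of_forall fun s => hC _)
  have h_fourier : Integrable (𝓕 fun s => χ s * φ (s - y)) := by
    simpa only [gaborCoeff_eq_fourierInv, Real.fourierInv_eq_fourier_neg, neg_neg] using
      (integrable_gaborCoeff_right hρ hσ hφ hχ y).comp_neg
  have h_inv : 𝓕 (𝓕⁻ fun s => χ s * φ (s - y)) t = χ t * φ (t - y) :=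
    congrFun ((hχ.fst.continuous.mul hc).fourier_fourierInv_eq hi h_fourier) t
  rw [← mul_assoc, ← h_inv, Real.fourier_eq, ← integral_mul_const]
  congr 1 with w
  rw [gaborCoeff_eq_fourierInv, gaborAtom, real_inner_comm, mul_smul_comm, smul_mul_assoc]

theorem integral_gaborCoeff_mul_gaborAtom (hρ : IsBaseWeight ρ) (hσ : IsBaseWeight σ)
    (hφ : BiRapid ρ σ φ) (hχ : BiRapid ρ σ χ) (t : E) :
    ∫ p, gaborCoeff φ χ p * gaborAtom φ p t = (∫ s, φ s * conj (φ s)) * χ t := by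
  obtain ⟨C, hC⟩ := hφ.fst.exists_norm_le
  have hi : Integrable fun p => gaborCoeff φ χ p * gaborAtom φ p t :=
    (integrable_gaborCoeff hρ hσ hφ hχ).mul_bdd (c := C)
      (continuous_gaborAtom_left hφ.fst.continuous t).aestronglyMeasurable
      (.of_forall fun p => (norm_gaborAtom φ p t).trans_le (hC _))
  rw [Measure.volume_eq_prod, integral_prod _ hi]
  simp only [integral_gaborCoeff_mul_gaborAtom_right hρ hσ hφ hχ]
  rw [integral_const_mul, integral_sub_left_eq_self (fun y => φ y * conj (φ y)), mul_comm]

theorem integrable_uncurry_gaborCoeff_mul_gaborAtom (hρ : IsBaseWeight ρ) (hσ : IsBaseWeight σ)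
    (hφ : BiRapid ρ σ φ) (hχ : BiRapid ρ σ χ) :
    Integrable (fun q : (E × E) × E => gaborCoeff φ χ q.1 * gaborAtom φ q.1 q.2) := by
  have hc : Continuous fun q : (E × E) × E => gaborCoeff φ χ q.1 * gaborAtom φ q.1 q.2 :=
    ((continuous_gaborCoeff hφ.fst (hχ.fst.integrable hρ)).comp continuous_fst).mul
      (continuous_uncurry_gaborAtom hφ.fst.continuous)
  refine (integrable_prod_iff hc.aestronglyMeasurable).2 ⟨.of_forall fun p => ?_, ?_⟩
  · exact ((hφ.fst.gaborAtom hρ p).integrable (μ := volume) hρ).const_mul (gaborCoeff φ χ p)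
  · simp only [norm_mul, norm_gaborAtom, integral_const_mul,
      integral_sub_right_eq_self fun t => ‖φ t‖]
    exact (integrable_gaborCoeff hρ hσ hφ hχ).norm.mul_const _

theorem integral_gaborCoeff_mul_fourier_gaborAtom (hρ : IsBaseWeight ρ) (hσ : IsBaseWeight σ)
    (hφ : BiRapid ρ σ φ) (hχ : BiRapid ρ σ χ) (τ : E) :
    ∫ p, gaborCoeff φ χ p * 𝓕 (gaborAtom φ p) τ = (∫ s, φ s * conj (φ s)) * 𝓕 χ τ := by
  have hi : Integrable (fun q : (E × E) × E =>
      𝐞 (-inner ℝ q.2 τ) • (gaborCoeff φ χ q.1 * gaborAtom φ q.1 q.2)) := by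
    have h := integrable_uncurry_gaborCoeff_mul_gaborAtom hρ hσ hφ hχ
    have hc : Continuous fun q : (E × E) × E => (𝐞 (-inner ℝ q.2 τ) : ℂ) := by fun_prop
    exact (integrable_norm_iff (hc.aestronglyMeasurable.smul h.aestronglyMeasurable)).1 <| by
      simpa only [Pi.smul_apply', norm_smul, Circle.norm_coe, one_mul] using h.norm
  calc ∫ p, gaborCoeff φ χ p * 𝓕 (gaborAtom φ p) τ
      = ∫ p, ∫ t, 𝐞 (-inner ℝ t τ) • (gaborCoeff φ χ p * gaborAtom φ p t) := by
        simp only [Real.fourier_eq, ← integral_const_mul, mul_smul_comm]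
    _ = ∫ t, ∫ p, 𝐞 (-inner ℝ t τ) • (gaborCoeff φ χ p * gaborAtom φ p t) :=
        integral_integral_swap hi
    _ = ∫ t, 𝐞 (-inner ℝ t τ) • ((∫ s, φ s * conj (φ s)) * χ t) := by
        simp only [Circle.smul_def, integral_smul, integral_gaborCoeff_mul_gaborAtom hρ hσ hφ hχ]
    _ = (∫ s, φ s * conj (φ s)) * 𝓕 χ τ := by
        simp only [Real.fourier_eq, ← integral_const_mul, mul_smul_comm]

end PointwiseReproducing

section WeakReproducing

open scoped BoundedContinuousFunction Topology

theorem exists_continuousLinearMap_of_norm_le {𝕜 V X : Type*} [RCLike 𝕜] [AddCommGroup V]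
    [Module 𝕜 V] [NormedAddCommGroup X] [NormedSpace 𝕜 X] (J : V →ₗ[𝕜] X) (F : V →ₗ[𝕜] 𝕜) (C : ℝ)
    (hF : ∀ v, ‖F v‖ ≤ C * ‖J v‖) : ∃ L : X →L[𝕜] 𝕜, ∀ v, L (J v) = F v := by
  obtain ⟨g, hg⟩ := J.rangeRestrict.exists_rightInverse_of_surjective J.range_rangeRestrict
  have hJg (u : J.range) : J (g u) = u := congrArg Subtype.val (LinearMap.congr_fun hg u)
  let F' : StrongDual 𝕜 J.range := (F ∘ₗ g).mkContinuous C fun u => by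
    have h_bound := hF (g u)
    rwa [hJg] at h_bound
  obtain ⟨L, hL, -⟩ := exists_extension_norm_eq J.range F'
  refine ⟨L, fun v => (hL ⟨J v, v, rfl⟩).trans ?_⟩
  have h_kernel := hF (g ⟨J v, v, rfl⟩ - v)
  rw [map_sub J, hJg, sub_self, norm_zero, mul_zero, norm_le_zero_iff, map_sub, sub_eq_zero]
    at h_kernel
  exact h_kernel

theorem continuous_boundedContinuousFunction_of_decay {Y X β : Type*} [TopologicalSpace Y]
    [SeminormedAddCommGroup X] [ProperSpace X] [SeminormedAddCommGroup β]
    (Φ : Y → X →ᵇ β) (hc : Continuous fun q : Y × X => Φ q.1 q.2)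
    (hd : ∀ y₀, ∃ C : ℝ, ∀ᶠ y in 𝓝 y₀, ∀ t, (1 + ‖t‖) * ‖Φ y t‖ ≤ C) : Continuous Φ := by
  refine continuous_iff_continuousAt.2 fun y₀ => Metric.tendsto_nhds.2 fun ε hε => ?_
  obtain ⟨C, hC⟩ := hd y₀
  obtain ⟨R, hR⟩ := exists_gt (4 * C / ε)
  have h_ball : ∀ᶠ y in 𝓝 y₀, ∀ t ∈ Metric.closedBall (0 : X) R,
      dist (Φ y t) (Φ y₀ t) < ε / 2 := by
    refine (isCompact_closedBall _ _).eventually_forall_of_forall_eventually fun t _ => ?_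
    have h_dist : Continuous fun q : Y × X => dist (Φ q.1 q.2) (Φ y₀ q.2) :=
      hc.dist (hc.comp (by fun_prop : Continuous fun q : Y × X => (y₀, q.2)))
    exact h_dist.tendsto (y₀, t) |>.eventually (gt_mem_nhds (by simpa using half_pos hε))
  filter_upwards [h_ball, hC] with y hy hy'
  refine lt_of_le_of_lt ((BoundedContinuousFunction.dist_le (half_pos hε).le).2 fun t => ?_)
    (half_lt_self hε)
  rcases le_or_gt ‖t‖ R with ht | ht
  · exact (hy t (by simpa using ht)).le
  · have h_tail (z : Y) (hz : ∀ t, (1 + ‖t‖) * ‖Φ z t‖ ≤ C) : ‖Φ z t‖ ≤ ε / 4 := by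
      by_contra! h_lt
      rw [div_lt_iff₀ hε] at hR
      nlinarith [hz t, norm_nonneg t]
    rw [dist_eq_norm]
    linarith [norm_sub_le (Φ y t) (Φ y₀ t), h_tail y hy', h_tail y₀ hC.self_of_nhds]

section WeightedBCF

variable {E : Type*} [NormedAddCommGroup E] {ρ : E → ℝ}

/-- Multiplication by the `k`-th power of the weight `ρ`, as a bounded continuous function. -/
def weightedBCF (hρ : IsBaseWeight ρ) (k : ℕ)
    {f : E → ℂ} (hf : Rapid ρ f) : E →ᵇ ℂ :=
  .ofNormedAddCommGroup (fun t => ρ t ^ k • f t) ((hρ.continuous.pow k).smul hf.continuous)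
    (hf.decay k).choose fun t => by
      rw [norm_smul, Real.norm_of_nonneg (hρ.pow_pos k t).le]
      exact (hf.decay k).choose_spec t

theorem weightedBCF_apply (hρ : IsBaseWeight ρ) (k : ℕ) {f : E → ℂ} (hf : Rapid ρ f) (t : E) :
    weightedBCF hρ k hf t = ρ t ^ k • f t := rfl

theorem norm_weightedBCF_apply (hρ : IsBaseWeight ρ) (k : ℕ) {f : E → ℂ} (hf : Rapid ρ f) (t : E) :
    ‖weightedBCF hρ k hf t‖ = ρ t ^ k * ‖f t‖ := by
  rw [weightedBCF_apply, norm_smul, Real.norm_of_nonneg (hρ.pow_pos k t).le]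

theorem norm_weightedBCF_le_iff (hρ : IsBaseWeight ρ) {k : ℕ} {f : E → ℂ} (hf : Rapid ρ f) {A : ℝ} :
    ‖weightedBCF hρ k hf‖ ≤ A ↔ ∀ t, ρ t ^ k * ‖f t‖ ≤ A := by
  simp only [BoundedContinuousFunction.norm_le_of_nonempty, norm_weightedBCF_apply]

theorem continuous_weightedBCF {Y : Type*} [TopologicalSpace Y] [ProperSpace E]
    (hρ : IsBaseWeight ρ) (k : ℕ)
    {g : Y → E → ℂ} (hg : ∀ y, Rapid ρ (g y)) (hc : Continuous fun q : Y × E => g q.1 q.2)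
    {w : Y → ℝ} (hw : Continuous w) (hle : ∀ y, ‖weightedBCF hρ (k + 1) (hg y)‖ ≤ w y) :
    Continuous fun y => weightedBCF hρ k (hg y) := by
  refine continuous_boundedContinuousFunction_of_decay _
    (((hρ.continuous.comp continuous_snd).pow k).smul hc) fun y₀ => ⟨w y₀ + 1, ?_⟩
  filter_upwards [(hw.tendsto y₀).eventually (gt_mem_nhds (lt_add_one _))] with y hy t
  have ht := hρ.pow_pos k t
  calc (1 + ‖t‖) * ‖weightedBCF hρ k (hg y) t‖ ≤ ρ t ^ (k + 1) * ‖g y t‖ := by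
        rw [norm_weightedBCF_apply, ← mul_assoc, pow_succ']
        gcongr
        exact hρ.one_add_norm_le t
    _ ≤ w y := (norm_weightedBCF_le_iff hρ (hg y)).1 (hle y) t
    _ ≤ w y₀ + 1 := hy.le

end WeightedBCF

variable {E : Type*} [NormedAddCommGroup E] [InnerProductSpace ℝ E] [FiniteDimensional ℝ E]
  [MeasurableSpace E] [BorelSpace E] {ρ σ : E → ℝ} {f φ χ : E → ℂ}

/-- The pair `(ρ^k f, σ^k 𝓕 f)`, whose norm is the larger of the two weighted suprema of `f` and of
its Fourier transform. -/
def weightedPair (hρ : IsBaseWeight ρ) (hσ : IsBaseWeight σ) (k : ℕ) (hf : BiRapid ρ σ f) :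
    (E →ᵇ ℂ) × (E →ᵇ ℂ) :=
  (weightedBCF hρ k hf.fst, weightedBCF hσ k hf.snd)

theorem norm_weightedPair_le_iff (hρ : IsBaseWeight ρ) (hσ : IsBaseWeight σ) {k : ℕ}
    (hf : BiRapid ρ σ f) {A : ℝ} :
    ‖weightedPair hρ hσ k hf‖ ≤ A ↔
      (∀ t, ρ t ^ k * ‖f t‖ ≤ A) ∧ ∀ ξ, σ ξ ^ k * ‖𝓕 f ξ‖ ≤ A := by
  rw [weightedPair, Prod.norm_mk, max_le_iff, norm_weightedBCF_le_iff, norm_weightedBCF_le_iff]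

theorem norm_weightedPair_gaborAtom_le (hρ : IsBaseWeight ρ) (hσ : IsBaseWeight σ) (k : ℕ)
    (hφ : BiRapid ρ σ φ) (p : E × E) :
    ‖weightedPair hρ hσ k (hφ.gaborAtom hρ hσ p)‖ ≤
      ‖weightedPair hρ hσ k hφ‖ * (ρ p.1 ^ k * σ p.2 ^ k) := by
  obtain ⟨hA, hB⟩ := (norm_weightedPair_le_iff hρ hσ hφ (k := k)).1 le_rfl
  have hρ1 : 1 ≤ ρ p.1 ^ k := one_le_pow₀ (hρ.one_le _)
  have hσ1 : 1 ≤ σ p.2 ^ k := one_le_pow₀ (hσ.one_le _)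
  have := norm_nonneg (weightedPair hρ hσ k hφ)
  refine (norm_weightedPair_le_iff hρ hσ _).2 ⟨fun t => ?_, fun τ => ?_⟩
  · rw [norm_gaborAtom]
    refine (hρ.pow_mul_norm_comp_sub_le hA p.1 t).trans ?_
    rw [mul_comm]
    gcongr
    exact le_mul_of_one_le_right (by positivity) hσ1
  · have hB_neg (ξ : E) : σ ξ ^ k * ‖𝓕 φ (-ξ)‖ ≤ ‖weightedPair hρ hσ k hφ‖ := hσ.neg ξ ▸ hB (-ξ)
    rw [norm_fourier_gaborAtom, ← sub_neg_eq_add]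
    refine (hσ.pow_mul_norm_comp_sub_le hB_neg (-p.2) τ).trans ?_
    rw [mul_comm, hσ.neg]
    gcongr
    exact le_mul_of_one_le_left (by positivity) hρ1

theorem continuous_uncurry_fourier_gaborAtom (hφ : Continuous (𝓕 φ)) :
    Continuous fun q : (E × E) × E => 𝓕 (gaborAtom φ q.1) q.2 := by
  simp only [fourier_gaborAtom]
  exact (Real.continuous_fourierChar.comp (by fun_prop)).smul
    (Complex.continuous_conj.comp (hφ.comp (by fun_prop)))

theorem continuous_weightedPair_gaborAtom (hρ : IsBaseWeight ρ) (hσ : IsBaseWeight σ) (k : ℕ)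
    (hφ : BiRapid ρ σ φ) :
    Continuous fun p => weightedPair hρ hσ k (hφ.gaborAtom hρ hσ p) := by
  have hw : Continuous fun p : E × E =>
      ‖weightedPair hρ hσ (k + 1) hφ‖ * (ρ p.1 ^ (k + 1) * σ p.2 ^ (k + 1)) :=
    continuous_const.mul (((hρ.continuous.comp continuous_fst).pow _).mul
      ((hσ.continuous.comp continuous_snd).pow _))
  have hle := norm_weightedPair_gaborAtom_le hρ hσ (k + 1) hφ
  exact (continuous_weightedBCF hρ k _ (continuous_uncurry_gaborAtom hφ.fst.continuous) hw
      fun p => (le_max_left _ _).trans (hle p)).prodMk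
    (continuous_weightedBCF hσ k _ (continuous_uncurry_fourier_gaborAtom hφ.snd.continuous) hw
      fun p => (le_max_right _ _).trans (hle p))

theorem integrable_gaborCoeff_smul_weightedPair (hρ : IsBaseWeight ρ) (hσ : IsBaseWeight σ)
    (k : ℕ) (hφ : BiRapid ρ σ φ) (hχ : BiRapid ρ σ χ) :
    Integrable fun p => gaborCoeff φ χ p • weightedPair hρ hσ k (hφ.gaborAtom hρ hσ p) := by
  have := secondCountableTopologyEither_of_left (E × E) ((E →ᵇ ℂ) × (E →ᵇ ℂ))
  refine ((integrable_pow_mul_pow_mul_norm_gaborCoeff hρ hσ hφ hχ k).const_mul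
    ‖weightedPair hρ hσ k hφ‖).mono' ?_ (.of_forall fun p => ?_)
  · exact ((continuous_gaborCoeff hφ.fst (hχ.fst.integrable hρ)).smul
      (continuous_weightedPair_gaborAtom hρ hσ k hφ)).aestronglyMeasurable
  · rw [norm_smul, mul_comm, ← mul_assoc]
    gcongr
    exact norm_weightedPair_gaborAtom_le hρ hσ k hφ p

theorem integral_gaborCoeff_smul_weightedPair (hρ : IsBaseWeight ρ) (hσ : IsBaseWeight σ)
    (k : ℕ) (hφ : BiRapid ρ σ φ) (hχ : BiRapid ρ σ χ) :
    ∫ p, gaborCoeff φ χ p • weightedPair hρ hσ k (hφ.gaborAtom hρ hσ p) =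
      (∫ s, φ s * conj (φ s)) • weightedPair hρ hσ k hχ := by
  have hi := integrable_gaborCoeff_smul_weightedPair hρ hσ k hφ hχ
  refine Prod.ext (BoundedContinuousFunction.ext fun t => ?_)
    (BoundedContinuousFunction.ext fun t => ?_)
  · have h_eval := (BoundedContinuousFunction.evalCLM ℂ t ∘L
      ContinuousLinearMap.fst ℂ (E →ᵇ ℂ) (E →ᵇ ℂ)).integral_comp_comm hi
    refine h_eval.symm.trans ?_
    simp only [weightedPair, ContinuousLinearMap.comp_apply, ContinuousLinearMap.coe_fst',
      BoundedContinuousFunction.evalCLM_apply, Prod.smul_fst, BoundedContinuousFunction.smul_apply,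
      weightedBCF_apply, smul_eq_mul, mul_smul_comm, integral_smul,
      integral_gaborCoeff_mul_gaborAtom hρ hσ hφ hχ]
  · have h_eval := (BoundedContinuousFunction.evalCLM ℂ t ∘L
      ContinuousLinearMap.snd ℂ (E →ᵇ ℂ) (E →ᵇ ℂ)).integral_comp_comm hi
    refine h_eval.symm.trans ?_
    simp only [weightedPair, ContinuousLinearMap.comp_apply, ContinuousLinearMap.coe_snd',
      BoundedContinuousFunction.evalCLM_apply, Prod.smul_snd, BoundedContinuousFunction.smul_apply,
      weightedBCF_apply, smul_eq_mul, mul_smul_comm, integral_smul,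
      integral_gaborCoeff_mul_fourier_gaborAtom hρ hσ hφ hχ]

variable {V : Type*} [AddCommGroup V] [Module ℂ V]

/-- `weightedPair` as a linear map on a space of functions. -/
def weightedEmbedding (hρ : IsBaseWeight ρ) (hσ : IsBaseWeight σ) (k : ℕ) (T : V →ₗ[ℂ] (E → ℂ))
    (hT : ∀ v, BiRapid ρ σ (T v)) : V →ₗ[ℂ] (E →ᵇ ℂ) × (E →ᵇ ℂ) where
  toFun v := weightedPair hρ hσ k (hT v)
  map_add' u v := by
    have h_fourier : 𝓕 (T u + T v) = 𝓕 (T u) + 𝓕 (T v) :=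
      VectorFourier.fourierIntegral_add Real.continuous_fourierChar
        continuous_inner ((hT u).fst.integrable hρ) ((hT v).fst.integrable hρ)
    ext t
    · simp [weightedPair, weightedBCF_apply]
    · simp [weightedPair, weightedBCF_apply, h_fourier]
  map_smul' c v := by
    have h_fourier : 𝓕 (c • T v) = c • 𝓕 (T v) :=
      VectorFourier.fourierIntegral_const_smul _ _ _ _ _
    ext t
    · simp [weightedPair, weightedBCF_apply, mul_left_comm]
    · simp [weightedPair, weightedBCF_apply, h_fourier, mul_left_comm]

theorem weak_reproducing_formula (hρ : IsBaseWeight ρ) (hσ : IsBaseWeight σ) (k : ℕ)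
    (T : V →ₗ[ℂ] (E → ℂ)) (hT : ∀ v, BiRapid ρ σ (T v)) (hφ : BiRapid ρ σ φ) (v : E × E → V)
    (hv : ∀ p, T (v p) = gaborAtom φ p) (F : V →ₗ[ℂ] ℂ) (C : ℝ)
    (hF : ∀ u, ‖F u‖ ≤ C * ‖weightedPair hρ hσ k (hT u)‖) :
    Continuous (fun p => F (v p)) ∧
    ∀ χ : V, Integrable (fun p => gaborCoeff φ (T χ) p * F (v p)) ∧
      ∫ p, gaborCoeff φ (T χ) p * F (v p) = (∫ s, φ s * conj (φ s)) * F χ := by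
  obtain ⟨L, hL⟩ :=
    exists_continuousLinearMap_of_norm_le (weightedEmbedding hρ hσ k T hT) F C hF
  have hLv (p : E × E) : L (weightedPair hρ hσ k (hφ.gaborAtom hρ hσ p)) = F (v p) := by
    rw [← hL (v p)]
    simp only [weightedEmbedding, LinearMap.coe_mk, AddHom.coe_mk, hv]
  have hL_smul (χ : V) (p : E × E) :
      L (gaborCoeff φ (T χ) p • weightedPair hρ hσ k (hφ.gaborAtom hρ hσ p)) =
        gaborCoeff φ (T χ) p * F (v p) := by
    rw [map_smul, hLv, smul_eq_mul]
  refine ⟨?_, fun χ => ?_⟩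
  · exact (L.continuous.comp (continuous_weightedPair_gaborAtom hρ hσ k hφ)).congr hLv
  have hi := integrable_gaborCoeff_smul_weightedPair hρ hσ k hφ (hT χ)
  simp only [← hL_smul]
  refine ⟨L.integrable_comp hi, ?_⟩
  rw [L.integral_comp_comm hi, integral_gaborCoeff_smul_weightedPair hρ hσ k hφ (hT χ), map_smul,
    smul_eq_mul, ← hL χ]
  rfl

end WeakReproducing

/-! ### Seminorms of `𝒦₁` -/

namespace K1

variable {n : ℕ}

theorem contDiff (χ : K1 n) : ContDiff ℝ ∞ (χ : RSpace n → ℂ) := χ.2.1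

theorem le_seminorm (χ : K1 n) (k j : ℕ) (t : RSpace n) :
    Real.exp (k * ‖t‖) * ‖iteratedFDeriv ℝ j χ t‖ ≤ seminormFamily n (k, j) χ := by
  obtain ⟨C, hC⟩ := χ.2.2 k j
  exact le_ciSup (f := fun t => Real.exp (k * ‖t‖) * ‖iteratedFDeriv ℝ j χ t‖)
    ⟨C, Set.forall_mem_range.2 hC⟩ t

theorem seminorm_le (χ : K1 n) (k j : ℕ) {A : ℝ}
    (h : ∀ t, Real.exp (k * ‖t‖) * ‖iteratedFDeriv ℝ j χ t‖ ≤ A) :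
    seminormFamily n (k, j) χ ≤ A :=
  ciSup_le h

theorem seminorm_mono (χ : K1 n) {k k' : ℕ} (h : k ≤ k') (j : ℕ) :
    seminormFamily n (k, j) χ ≤ seminormFamily n (k', j) χ := by
  refine seminorm_le χ k j fun t => le_trans ?_ (le_seminorm χ k' j t)
  gcongr

/-- The sum of the seminorms of `𝒦₁` of exponential order `k` and differential order at
most `N`. These norms are directed and generate the topology of `𝒦₁`. -/
def sumSeminorm (k N : ℕ) (χ : K1 n) : ℝ :=
  ∑ j ∈ Finset.range (N + 1), seminormFamily n (k, j) χ

theorem sumSeminorm_nonneg (k N : ℕ) (χ : K1 n) : 0 ≤ sumSeminorm k N χ :=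
  Finset.sum_nonneg fun _ _ => apply_nonneg _ _

theorem sumSeminorm_mono (χ : K1 n) {k k' N N' : ℕ} (hk : k ≤ k') (hN : N ≤ N') :
    sumSeminorm k N χ ≤ sumSeminorm k' N' χ :=
  (Finset.sum_le_sum fun j _ => seminorm_mono χ hk j).trans <|
    Finset.sum_le_sum_of_subset_of_nonneg (Finset.range_mono (by lia)) fun _ _ _ =>
      apply_nonneg _ _

theorem seminorm_le_sumSeminorm (k N : ℕ) (χ : K1 n) {j : ℕ} (hj : j ≤ N) :
    seminormFamily n (k, j) χ ≤ sumSeminorm k N χ :=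
  Finset.single_le_sum (f := fun j => seminormFamily n (k, j) χ)
    (fun _ _ => apply_nonneg _ _) (Finset.mem_range.2 (Nat.lt_succ_of_le hj))

theorem exists_norm_le_sumSeminorm (F : K1Dual n) :
    ∃ (k N : ℕ) (C : ℝ), 0 ≤ C ∧ ∀ χ, ‖F χ‖ ≤ C * sumSeminorm k N χ := by
  have hc : Continuous ((normSeminorm ℂ ℂ).comp F.toLinearMap) :=
    continuous_norm.comp F.continuous
  obtain ⟨s, C, -, hC⟩ := Seminorm.bound_of_continuous (K1.withSeminorms n) _ hc
  refine ⟨s.sup Prod.fst, s.sup Prod.snd, C, C.2, fun χ => ?_⟩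
  calc ‖F χ‖ ≤ C * s.sup (seminormFamily n) χ := hC χ
    _ ≤ C * sumSeminorm (s.sup Prod.fst) (s.sup Prod.snd) χ := by
      gcongr
      refine Seminorm.finset_sup_apply_le (sumSeminorm_nonneg _ _ _) fun i hi => ?_
      exact (seminorm_mono χ (Finset.le_sup (f := Prod.fst) hi) i.2).trans
        (seminorm_le_sumSeminorm _ _ χ (Finset.le_sup (f := Prod.snd) hi))

theorem exp_pow_mul_norm_le (χ : K1 n) (k : ℕ) (t : RSpace n) :
    Real.exp ‖t‖ ^ k * ‖χ t‖ ≤ seminormFamily n (k, 0) χ := by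
  simpa only [← Real.exp_nat_mul, norm_iteratedFDeriv_zero] using le_seminorm χ k 0 t

theorem rapid (χ : K1 n) : Rapid (fun t => Real.exp ‖t‖) χ :=
  ⟨χ.contDiff.continuous, fun k => ⟨_, χ.exp_pow_mul_norm_le k⟩⟩

theorem norm_iteratedFDeriv_le (χ : K1 n) (k j : ℕ) (t : RSpace n) :
    ‖iteratedFDeriv ℝ j χ t‖ ≤ (Real.exp ‖t‖ ^ k)⁻¹ * seminormFamily n (k, j) χ := by
  rw [le_inv_mul_iff₀ (by positivity), ← Real.exp_nat_mul]
  exact le_seminorm χ k j t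

theorem integrable_norm_iteratedFDeriv (χ : K1 n) (j : ℕ) :
    Integrable fun t => ‖iteratedFDeriv ℝ j χ t‖ :=
  ((isBaseWeight_exp_norm.integrable_inv_pow).mul_const _).mono'
    (χ.contDiff.continuous_iteratedFDeriv (by exact_mod_cast le_top)).norm.aestronglyMeasurable
    (.of_forall fun t => (norm_norm _).trans_le (χ.norm_iteratedFDeriv_le _ j t))

theorem integral_norm_iteratedFDeriv_le (χ : K1 n) (j : ℕ) :
    ∫ t, ‖iteratedFDeriv ℝ j χ t‖ ≤ (∫ t : RSpace n, (Real.exp ‖t‖ ^ (n + 1))⁻¹) *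
      seminormFamily n (n + 1, j) χ := by
  have hi : Integrable fun t : RSpace n => (Real.exp ‖t‖ ^ (n + 1))⁻¹ := by
    simpa only [finrank_euclideanSpace_fin] using
      isBaseWeight_exp_norm.integrable_inv_pow (E := RSpace n) (μ := volume)
  rw [← integral_mul_const]
  exact integral_mono (χ.integrable_norm_iteratedFDeriv j) (hi.mul_const _)
    (χ.norm_iteratedFDeriv_le (n + 1) j)

theorem norm_pow_mul_norm_fourier_le (χ : K1 n) (N : ℕ) (ξ : RSpace n) :
    ‖ξ‖ ^ N * ‖𝓕 (χ : RSpace n → ℂ) ξ‖ ≤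
      2 ^ N * ((∫ t : RSpace n, (Real.exp ‖t‖ ^ (n + 1))⁻¹) * sumSeminorm (n + 1) N χ) := by
  have h := Real.pow_mul_norm_iteratedFDeriv_fourier_le (K := 0) (N := ⊤)
    (f := (χ : RSpace n → ℂ)) χ.contDiff
    (fun k j hk _ => by
      obtain rfl : k = 0 := by simpa using hk
      simpa only [pow_zero, one_mul] using χ.integrable_norm_iteratedFDeriv j)
    (k := 0) (n := N) le_rfl (by simp) ξ
  simp only [norm_iteratedFDeriv_zero, pow_zero, one_mul, CharP.cast_eq_zero, mul_zero, zero_add,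
    Finset.range_one, Finset.singleton_product, Finset.sum_map, Function.Embedding.coeFn_mk] at h
  refine h.trans ?_
  simp only [sumSeminorm, Finset.mul_sum]
  gcongr with j
  exact χ.integral_norm_iteratedFDeriv_le j

theorem exists_one_add_norm_pow_mul_norm_fourier_le (n N : ℕ) :
    ∃ C : ℝ, 0 ≤ C ∧ ∀ (χ : K1 n) (ξ : RSpace n),
      (1 + ‖ξ‖) ^ N * ‖𝓕 (χ : RSpace n → ℂ) ξ‖ ≤ C * sumSeminorm (n + 1) N χ := by
  set I := ∫ t : RSpace n, (Real.exp ‖t‖ ^ (n + 1))⁻¹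
  have : 0 ≤ I := integral_nonneg fun t => by positivity
  refine ⟨2 ^ (N - 1) * (1 + 2 ^ N) * I, by positivity, fun χ ξ => ?_⟩
  have h_zero : ‖𝓕 (χ : RSpace n → ℂ) ξ‖ ≤ I * sumSeminorm (n + 1) 0 χ := by
    simpa only [pow_zero, one_mul] using χ.norm_pow_mul_norm_fourier_le 0 ξ
  calc _ ≤ 2 ^ (N - 1) * (1 ^ N + ‖ξ‖ ^ N) * ‖𝓕 (χ : RSpace n → ℂ) ξ‖ := by
        gcongr
        exact add_pow_le zero_le_one (norm_nonneg ξ) N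
    _ = 2 ^ (N - 1) * (‖𝓕 (χ : RSpace n → ℂ) ξ‖ + ‖ξ‖ ^ N * ‖𝓕 (χ : RSpace n → ℂ) ξ‖) := by
        ring
    _ ≤ 2 ^ (N - 1) * (I * sumSeminorm (n + 1) N χ + 2 ^ N * (I * sumSeminorm (n + 1) N χ)) := by
        refine mul_le_mul_of_nonneg_left (add_le_add (h_zero.trans ?_)
          (χ.norm_pow_mul_norm_fourier_le N ξ)) (by positivity)
        gcongr
        exact χ.sumSeminorm_mono le_rfl N.zero_le
    _ = _ := by ring

theorem biRapid (χ : K1 n) : BiRapid (fun t => Real.exp ‖t‖) (fun ξ => 1 + ‖ξ‖) χ := by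
  refine ⟨χ.rapid, continuous_fourier_of_integrable (χ.rapid.integrable isBaseWeight_exp_norm),
    fun k => ?_⟩
  obtain ⟨C, -, hC⟩ := exists_one_add_norm_pow_mul_norm_fourier_le n k
  exact ⟨_, hC χ⟩

end K1

/-! ### Derivative estimates from decay of a function and its Fourier transform -/

section Interpolation

variable {E G : Type*} [NormedAddCommGroup E] [NormedSpace ℝ E] [NormedAddCommGroup G]
  [NormedSpace ℝ G]

theorem mul_norm_fderiv_le_of_fderiv_sub_le {f : E → G} {t : E} {B K h : ℝ} (hh : 0 < h)
    (hf : Differentiable ℝ f)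
    (hK : ∀ s ∈ Metric.closedBall t h, ‖fderiv ℝ f s - fderiv ℝ f t‖ ≤ K)
    (hB : ∀ s ∈ Metric.closedBall t h, ‖f s‖ ≤ B) :
    h * ‖fderiv ℝ f t‖ ≤ 2 * B + K * h := by
  have ht : t ∈ Metric.closedBall t h := Metric.mem_closedBall_self hh.le
  have hB₀ : 0 ≤ B := (norm_nonneg _).trans (hB t ht)
  have hK₀ : 0 ≤ K := (norm_nonneg _).trans (hK t ht)
  rw [mul_comm, ← le_div_iff₀ hh]
  refine ContinuousLinearMap.opNorm_le_of_unit_norm (by positivity) fun v hv => ?_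
  have h_norm : ‖h • v‖ = h := by rw [norm_smul, hv, mul_one, Real.norm_of_nonneg hh.le]
  have h_mem : t + h • v ∈ Metric.closedBall t h := by
    rw [mem_closedBall_iff_norm, add_sub_cancel_left, h_norm]
  have h_taylor : ‖f (t + h • v) - f t - fderiv ℝ f t (h • v)‖ ≤ K * h := by
    simpa only [add_sub_cancel_left, h_norm] using
      Convex.norm_image_sub_le_of_norm_fderiv_le' (fun x _ => hf x) hK (convex_closedBall t h)
        ht h_mem
  rw [le_div_iff₀ hh]
  calc ‖fderiv ℝ f t v‖ * h = ‖fderiv ℝ f t (h • v)‖ := by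
        rw [map_smul, norm_smul, Real.norm_of_nonneg hh.le, mul_comm]
    _ = ‖(f (t + h • v) - f t) - (f (t + h • v) - f t - fderiv ℝ f t (h • v))‖ := by
        congr 1; abel
    _ ≤ (‖f (t + h • v)‖ + ‖f t‖) + K * h := (norm_sub_le _ _).trans
        (add_le_add (norm_sub_le _ _) h_taylor)
    _ ≤ 2 * B + K * h := by linarith [hB _ h_mem, hB t ht]

theorem mul_norm_iteratedFDeriv_succ_le {f : E → G} (j : ℕ) (hf : ContDiff ℝ (j + 2 : ℕ) f)
    {M B h : ℝ} (hh : 0 < h) (t : E) (hM : ∀ s, ‖iteratedFDeriv ℝ (j + 2) f s‖ ≤ M)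
    (hB : ∀ s ∈ Metric.closedBall t h, ‖iteratedFDeriv ℝ j f s‖ ≤ B) :
    h * ‖iteratedFDeriv ℝ (j + 1) f t‖ ≤ 2 * B + M * h ^ 2 := by
  have hd (i : ℕ) (hi : i < j + 2) : Differentiable ℝ (iteratedFDeriv ℝ i f) :=
    hf.differentiable_iteratedFDeriv (by exact_mod_cast hi)
  have hM₀ : 0 ≤ M := (norm_nonneg _).trans (hM t)
  rw [← norm_fderiv_iteratedFDeriv, pow_two, ← mul_assoc]
  refine mul_norm_fderiv_le_of_fderiv_sub_le hh (hd j (by lia)) (fun s hs => ?_) hB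
  calc ‖fderiv ℝ (iteratedFDeriv ℝ j f) s - fderiv ℝ (iteratedFDeriv ℝ j f) t‖
      = ‖iteratedFDeriv ℝ (j + 1) f s - iteratedFDeriv ℝ (j + 1) f t‖ := by
        rw [fderiv_iteratedFDeriv]
        exact (dist_eq_norm _ _).symm.trans
          ((LinearIsometryEquiv.dist_map _ _ _).trans (dist_eq_norm _ _))
    _ ≤ M * ‖s - t‖ := Convex.norm_image_sub_le_of_norm_fderiv_le
        (fun x _ => hd (j + 1) (by lia) x)
        (fun x _ => by rw [norm_fderiv_iteratedFDeriv]; exact hM x) convex_univ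
        (Set.mem_univ _) (Set.mem_univ _)
    _ ≤ M * h := by gcongr; exact mem_closedBall_iff_norm.1 hs

theorem exp_mul_norm_iteratedFDeriv_succ_le {f : E → G} (k j : ℕ)
    (hf : ContDiff ℝ (j + 2 : ℕ) f) {B M : ℝ}
    (hB : ∀ s, Real.exp ((2 * k : ℕ) * ‖s‖) * ‖iteratedFDeriv ℝ j f s‖ ≤ B)
    (hM : ∀ s, ‖iteratedFDeriv ℝ (j + 2) f s‖ ≤ M) (t : E) :
    Real.exp (k * ‖t‖) * ‖iteratedFDeriv ℝ (j + 1) f t‖ ≤ 2 * (Real.exp (2 * k) * B) + M := by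
  set h := Real.exp (-(k * ‖t‖)) with hh
  have h_pos : 0 < h := Real.exp_pos _
  have h_le : h ≤ 1 := Real.exp_le_one_iff.2 (neg_nonpos.2 (by positivity))
  have h_near (s) (hs : s ∈ Metric.closedBall t h) :
      ‖iteratedFDeriv ℝ j f s‖ ≤ h ^ 2 * (Real.exp (2 * k) * B) := by
    have h_norm : ‖t‖ ≤ ‖s‖ + 1 := by
      rw [mem_closedBall_iff_norm'] at hs
      linarith [norm_le_norm_add_norm_sub' t s]
    have h_one : 1 ≤ h ^ 2 * Real.exp (2 * k) * Real.exp ((2 * k : ℕ) * ‖s‖) := by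
      rw [hh, ← Real.exp_nat_mul, ← Real.exp_add, ← Real.exp_add, Real.one_le_exp_iff]
      push_cast
      nlinarith [(Nat.cast_nonneg k : (0 : ℝ) ≤ k)]
    calc ‖iteratedFDeriv ℝ j f s‖
        ≤ h ^ 2 * Real.exp (2 * k) * Real.exp ((2 * k : ℕ) * ‖s‖) * ‖iteratedFDeriv ℝ j f s‖ :=
          le_mul_of_one_le_left (norm_nonneg _) h_one
      _ = h ^ 2 * (Real.exp (2 * k) *
            (Real.exp ((2 * k : ℕ) * ‖s‖) * ‖iteratedFDeriv ℝ j f s‖)) := by ring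
      _ ≤ h ^ 2 * (Real.exp (2 * k) * B) := by gcongr; exact hB s
  have h_interp := mul_norm_iteratedFDeriv_succ_le j hf h_pos t
    hM h_near
  rw [← neg_neg ((k : ℝ) * ‖t‖), Real.exp_neg, ← hh, inv_mul_le_iff₀ h_pos,
    ← mul_le_mul_iff_right₀ h_pos]
  exact h_interp.trans_eq (by ring)

end Interpolation

section Derivatives

variable {E : Type*} [NormedAddCommGroup E] [InnerProductSpace ℝ E] [FiniteDimensional ℝ E]
  [MeasurableSpace E] [BorelSpace E] {f : E → ℂ} {ρ : E → ℝ}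

theorem BiRapid.eq_fourier_fourier_neg {σ : E → ℝ} (hf : BiRapid ρ σ f) (hρ : IsBaseWeight ρ)
    (hσ : IsBaseWeight σ) : f = 𝓕 fun x => 𝓕 f (-x) := by
  rw [← Real.fourierInv_eq_fourier_comp_neg]
  exact (hf.fst.continuous.fourierInv_fourier_eq (hf.fst.integrable hρ)
    (hf.snd.integrable hσ)).symm

theorem integrable_norm_pow_mul_fourier_neg (hf : BiRapid ρ (fun ξ => 1 + ‖ξ‖) f) (k : ℕ) :
    Integrable fun v => ‖v‖ ^ k * ‖𝓕 f (-v)‖ := by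
  refine (hf.snd.integrable_pow_mul isBaseWeight_one_add_norm k).comp_neg.mono' ?_
    (.of_forall fun v => ?_)
  · exact ((continuous_norm.pow k).mul
      (hf.snd.continuous.comp continuous_neg).norm).aestronglyMeasurable
  · rw [Real.norm_of_nonneg (by positivity), norm_neg]
    gcongr
    linarith

theorem BiRapid.contDiff (hf : BiRapid ρ (fun ξ => 1 + ‖ξ‖) f) (hρ : IsBaseWeight ρ) :
    ContDiff ℝ ∞ f := by
  rw [hf.eq_fourier_fourier_neg hρ isBaseWeight_one_add_norm]
  exact Real.contDiff_fourier (N := ⊤) fun k _ => integrable_norm_pow_mul_fourier_neg hf k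

theorem norm_iteratedFDeriv_le_of_fourier_decay (hρ : IsBaseWeight ρ)
    (hf : BiRapid ρ (fun ξ => 1 + ‖ξ‖) f) (j : ℕ) {A : ℝ}
    (hA : ∀ ξ, (1 + ‖ξ‖) ^ (Module.finrank ℝ E + 1 + j) * ‖𝓕 f ξ‖ ≤ A) (t : E) :
    ‖iteratedFDeriv ℝ j f t‖ ≤ (2 * Real.pi * ‖innerSL (E := E) ℝ‖) ^ j *
      (∫ v : E, ((1 + ‖v‖) ^ (Module.finrank ℝ E + 1))⁻¹) * A := by
  have hc : Continuous fun v => 𝓕 f (-v) := hf.snd.continuous.comp continuous_neg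
  rw [hf.eq_fourier_fourier_neg hρ isBaseWeight_one_add_norm, Real.iteratedFDeriv_fourier (N := ⊤)
    (fun k _ => integrable_norm_pow_mul_fourier_neg hf k) hc.aestronglyMeasurable (by simp),
    mul_assoc, mul_comm _ A, ← integral_const_mul, ← integral_const_mul]
  refine norm_integral_le_of_norm_le
    ((isBaseWeight_one_add_norm.integrable_inv_pow.const_mul _).const_mul _)
    (.of_forall fun v => ?_)
  rw [Circle.norm_smul]
  refine (VectorFourier.norm_fourierPowSMulRight_le _ _ _ _).trans ?_
  rw [mul_assoc]
  refine mul_le_mul_of_nonneg_left ?_ (by positivity)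
  rw [← div_eq_mul_inv, le_div_iff₀ (by positivity)]
  calc ‖v‖ ^ j * ‖𝓕 f (-v)‖ * (1 + ‖v‖) ^ (Module.finrank ℝ E + 1)
      ≤ (1 + ‖v‖) ^ j * ‖𝓕 f (-v)‖ * (1 + ‖v‖) ^ (Module.finrank ℝ E + 1) := by
        gcongr; linarith
    _ = (1 + ‖-v‖) ^ (Module.finrank ℝ E + 1 + j) * ‖𝓕 f (-v)‖ := by rw [norm_neg]; ring
    _ ≤ A := hA (-v)

theorem exists_exp_mul_norm_iteratedFDeriv_le (E : Type*) [NormedAddCommGroup E]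
    [InnerProductSpace ℝ E] [FiniteDimensional ℝ E] [MeasurableSpace E] [BorelSpace E] (j k : ℕ) :
    ∃ (N : ℕ) (C : ℝ), 0 ≤ C ∧
      ∀ f : E → ℂ, BiRapid (fun t => Real.exp ‖t‖) (fun ξ => 1 + ‖ξ‖) f →
        ∀ A, (∀ t, Real.exp ‖t‖ ^ N * ‖f t‖ ≤ A) → (∀ ξ, (1 + ‖ξ‖) ^ N * ‖𝓕 f ξ‖ ≤ A) →
          ∀ t, Real.exp (k * ‖t‖) * ‖iteratedFDeriv ℝ j f t‖ ≤ C * A := by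
  induction j generalizing k with
  | zero =>
    refine ⟨k, 1, zero_le_one, fun f _ A hA _ t => ?_⟩
    rw [norm_iteratedFDeriv_zero, Real.exp_nat_mul, one_mul]
    exact hA t
  | succ j ih =>
    obtain ⟨N, C, hC, hC_bound⟩ := ih (2 * k)
    set D := (2 * Real.pi * ‖innerSL (E := E) ℝ‖) ^ (j + 2) *
      ∫ v : E, ((1 + ‖v‖) ^ (Module.finrank ℝ E + 1))⁻¹
    have : 0 ≤ D := mul_nonneg (by positivity) (integral_nonneg fun _ => by positivity)
    refine ⟨max N (Module.finrank ℝ E + 1 + (j + 2)), 2 * (Real.exp (2 * k) * C) + D,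
      by positivity, fun f hf A hA hA' t => ?_⟩
    have h_time (t) : Real.exp ‖t‖ ^ N * ‖f t‖ ≤ A :=
      le_trans (by gcongr; exacts [isBaseWeight_exp_norm.one_le t, le_max_left _ _]) (hA t)
    have h_freq (N') (hN' : N' ≤ max N (Module.finrank ℝ E + 1 + (j + 2))) (ξ) :
        (1 + ‖ξ‖) ^ N' * ‖𝓕 f ξ‖ ≤ A :=
      le_trans (by gcongr; exact isBaseWeight_one_add_norm.one_le ξ) (hA' ξ)
    refine (exp_mul_norm_iteratedFDeriv_succ_le k j
      (contDiff_infty.1 (hf.contDiff isBaseWeight_exp_norm) _)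
      (hC_bound f hf A h_time (h_freq N (le_max_left _ _)))
      (norm_iteratedFDeriv_le_of_fourier_decay isBaseWeight_exp_norm hf (j + 2)
        (h_freq _ (le_max_right _ _))) t).trans_eq ?_
    ring

end Derivatives

/-! ### Minkowski's and Young's inequalities -/

section Minkowski

variable {α β : Type*} [MeasurableSpace α] [MeasurableSpace β] {μ : Measure α} {ν : Measure β}

theorem eLpNorm_ennreal_eq_lintegral_rpow {p : ℝ≥0∞} (hp : p ≠ 0) (hp' : p ≠ ⊤) (f : α → ℝ≥0∞) :
    eLpNorm f p μ = (∫⁻ x, f x ^ p.toReal ∂μ) ^ (1 / p.toReal) := by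
  simp only [eLpNorm_eq_lintegral_rpow_enorm_toReal hp hp',
    enorm_eq_self]

theorem eLpNorm_ennreal_rpow_toReal {p : ℝ≥0∞} (hp : p ≠ 0) (hp' : p ≠ ⊤) (f : α → ℝ≥0∞) :
    eLpNorm f p μ ^ p.toReal = ∫⁻ x, f x ^ p.toReal ∂μ := by
  rw [eLpNorm_ennreal_eq_lintegral_rpow hp hp', one_div,
    ENNReal.rpow_inv_rpow (ENNReal.toReal_pos hp hp').ne']

theorem eLpNorm_top_le_iff_ae_le {f : α → ℝ≥0∞} {c : ℝ≥0∞} :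
    eLpNorm f ⊤ μ ≤ c ↔ ∀ᵐ x ∂μ, f x ≤ c := by
  rw [eLpNorm_exponent_top]
  refine ⟨fun h => ?_, fun h => eLpNormEssSup_le_of_ae_enorm_bound h⟩
  filter_upwards [enorm_ae_le_eLpNormEssSup f μ] with x hx using hx.trans h

theorem measurable_eLpNorm_left [SFinite μ] {g : α → β → ℝ≥0∞}
    (hg : Measurable (Function.uncurry g)) (p : ℝ≥0∞) :
    Measurable fun y => eLpNorm (fun x => g x y) p μ := by
  rcases eq_or_ne p 0 with rfl | hp
  · simp only [eLpNorm_exponent_zero, measurable_const]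
  rcases eq_or_ne p ⊤ with rfl | hp'
  · refine measurable_of_Iic fun c => ?_
    have hpre : (fun y => eLpNorm (fun x => g x y) ⊤ μ) ⁻¹' Set.Iic c =
        (fun y => μ ((fun x => (x, y)) ⁻¹' {q : α × β | ¬ g q.1 q.2 ≤ c})) ⁻¹' {0} := by
      ext y
      exact eLpNorm_top_le_iff_ae_le.trans ae_iff
    rw [hpre]
    exact measurable_measure_prodMk_right (measurableSet_le hg measurable_const).compl
      (measurableSet_singleton 0)
  · simp only [eLpNorm_ennreal_eq_lintegral_rpow hp hp']
    exact (Measurable.lintegral_prod_left' (hg.pow_const _)).pow_const _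

/-- Hölder's inequality for `f = N ^ (1 - 1/r) * (f * N ^ (1/r - 1))`. -/
theorem lintegral_rpow_le_mul_lintegral_mul_rpow {f N : β → ℝ≥0∞} (hf : Measurable f)
    (hN : Measurable N) (hN_top : ∀ᵐ y ∂ν, N y ≠ ⊤) (hfN : ∀ᵐ y ∂ν, N y = 0 → f y = 0)
    {r : ℝ} (hr : 1 < r) :
    (∫⁻ y, f y ∂ν) ^ r ≤ (∫⁻ y, N y ∂ν) ^ (r - 1) * ∫⁻ y, N y ^ (1 - r) * f y ^ r ∂ν := by
  have hconj := Real.HolderConjugate.conjExponent hr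
  have hr0 : 0 < r := hconj.pos
  set s := r.conjExponent
  have hs : 1 / s * r = r - 1 := by rw [one_div, inv_mul_eq_div, hconj.div_conj_eq_sub_one]
  have hsplit : ∀ᵐ y ∂ν, f y ≤ N y ^ (1 / s) * (N y ^ (-(1 / s)) * f y) := by
    filter_upwards [hN_top, hfN] with y hy_top hy_zero
    rcases eq_or_ne (N y) 0 with h0 | h0
    · simp [hy_zero h0]
    · rw [← mul_assoc, ← ENNReal.rpow_add _ _ h0 hy_top, add_neg_cancel, ENNReal.rpow_zero, one_mul]
  have hholder : ∫⁻ y, f y ∂ν ≤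
      (∫⁻ y, N y ∂ν) ^ (1 / s) * (∫⁻ y, N y ^ (1 - r) * f y ^ r ∂ν) ^ (1 / r) := by
    have h := ENNReal.lintegral_mul_le_Lp_mul_Lq ν hconj.symm (hN.pow_const (1 / s)).aemeasurable
      ((hN.pow_const (-(1 / s))).mul hf).aemeasurable
    simp only [Pi.mul_apply, ENNReal.mul_rpow_of_nonneg _ _ hr0.le, ← ENNReal.rpow_mul, neg_mul,
      hs, neg_sub, one_div_mul_cancel hconj.symm.ne_zero, ENNReal.rpow_one] at h
    exact (lintegral_mono_ae hsplit).trans h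
  calc (∫⁻ y, f y ∂ν) ^ r
      ≤ ((∫⁻ y, N y ∂ν) ^ (1 / s) * (∫⁻ y, N y ^ (1 - r) * f y ^ r ∂ν) ^ (1 / r)) ^ r := by gcongr
    _ = _ := by
      rw [ENNReal.mul_rpow_of_nonneg _ _ hr0.le, ← ENNReal.rpow_mul, ← ENNReal.rpow_mul, hs,
        one_div_mul_cancel hr0.ne', ENNReal.rpow_one]

theorem ae_ae_eLpNorm_eq_zero_imp [SFinite μ] [SFinite ν] {g : α → β → ℝ≥0∞}
    (hg : Measurable (Function.uncurry g)) {p : ℝ≥0∞} (hp : p ≠ 0) :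
    ∀ᵐ x ∂μ, ∀ᵐ y ∂ν, eLpNorm (fun x => g x y) p μ = 0 → g x y = 0 := by
  have hN := measurable_eLpNorm_left (μ := μ) hg p
  have hmeas : MeasurableSet
      {z : α × β | eLpNorm (fun x => g x z.2) p μ = 0 → g z.1 z.2 = 0} := by
    simp only [imp_iff_not_or]
    exact (measurableSet_eq_fun (hN.comp measurable_snd) measurable_const).compl.union
      (measurableSet_eq_fun hg measurable_const)
  refine (Measure.ae_ae_comm hmeas).2 (.of_forall fun y => ?_)
  by_cases hy : eLpNorm (fun x => g x y) p μ = 0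
  · have hzero :=
      (eLpNorm_eq_zero_iff (hg.comp measurable_prodMk_right).aestronglyMeasurable hp).1 hy
    exact hzero.mono fun x hx _ => hx
  · exact .of_forall fun x h => absurd h hy

theorem lintegral_rpow_lintegral_le [SFinite μ] [SFinite ν] {g : α → β → ℝ≥0∞}
    (hg : Measurable (Function.uncurry g)) {p : ℝ≥0∞} (hp : 1 < p) (hp' : p ≠ ⊤) :
    ∫⁻ x, (∫⁻ y, g x y ∂ν) ^ p.toReal ∂μ ≤
      (∫⁻ y, eLpNorm (fun x => g x y) p μ ∂ν) ^ p.toReal := by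
  set N : β → ℝ≥0∞ := fun y => eLpNorm (fun x => g x y) p μ
  set r := p.toReal
  have hr : 1 < r := by simpa using (ENNReal.toReal_lt_toReal ENNReal.one_ne_top hp').2 hp
  have hr0 : 0 < r := one_pos.trans hr
  have hp0 : p ≠ 0 := (one_pos.trans hp).ne'
  have hN : Measurable N := measurable_eLpNorm_left hg p
  rcases eq_or_ne (∫⁻ y, N y ∂ν) ⊤ with htop | hfin
  · rw [htop, ENNReal.top_rpow_of_pos hr0]
    exact le_top
  have hN_top : ∀ᵐ y ∂ν, N y ≠ ⊤ := (ae_lt_top hN hfin).mono fun y hy => hy.ne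
  have hgN := ae_ae_eLpNorm_eq_zero_imp (μ := μ) (ν := ν) hg hp0
  calc ∫⁻ x, (∫⁻ y, g x y ∂ν) ^ r ∂μ
      ≤ ∫⁻ x, (∫⁻ y, N y ∂ν) ^ (r - 1) * ∫⁻ y, N y ^ (1 - r) * g x y ^ r ∂ν ∂μ := by
        refine lintegral_mono_ae (hgN.mono fun x hx => ?_)
        exact lintegral_rpow_le_mul_lintegral_mul_rpow (hg.comp measurable_prodMk_left) hN hN_top
          hx hr
    _ = (∫⁻ y, N y ∂ν) ^ (r - 1) * ∫⁻ x, ∫⁻ y, N y ^ (1 - r) * g x y ^ r ∂ν ∂μ :=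
        lintegral_const_mul' _ _ (ENNReal.rpow_ne_top_of_nonneg (by linarith) hfin)
    _ = (∫⁻ y, N y ∂ν) ^ (r - 1) * ∫⁻ y, N y ^ (1 - r) * N y ^ r ∂ν := by
        rw [lintegral_lintegral_swap (((hN.comp measurable_snd).pow_const _).mul
          (hg.pow_const r)).aemeasurable]
        simp only [N, r, eLpNorm_ennreal_rpow_toReal hp0 hp']
        congr 2 with y
        exact lintegral_const_mul _ ((hg.comp measurable_prodMk_right).pow_const _)
    _ ≤ (∫⁻ y, N y ∂ν) ^ (r - 1) * ∫⁻ y, N y ∂ν := by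
        refine mul_le_mul_right ?_ _
        refine lintegral_mono_ae (hN_top.mono fun y hy => ?_)
        rcases eq_or_ne (N y) 0 with h0 | h0
        · simp [h0, hr0]
        · simp only [← ENNReal.rpow_add _ _ h0 hy, sub_add_cancel, ENNReal.rpow_one, le_refl]
    _ = (∫⁻ y, N y ∂ν) ^ r := by
        nth_rw 2 [← ENNReal.rpow_one (∫⁻ y, N y ∂ν)]
        rw [← ENNReal.rpow_add_of_nonneg _ _ (by linarith) zero_le_one, sub_add_cancel]

theorem eLpNorm_lintegral_le [SFinite μ] [SFinite ν] {g : α → β → ℝ≥0∞}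
    (hg : Measurable (Function.uncurry g)) {p : ℝ≥0∞} (hp : 1 ≤ p) :
    eLpNorm (fun x => ∫⁻ y, g x y ∂ν) p μ ≤ ∫⁻ y, eLpNorm (fun x => g x y) p μ ∂ν := by
  rcases eq_or_ne p ⊤ with rfl | hp'
  · have hN := measurable_eLpNorm_left (μ := μ) hg ⊤
    have hle : ∀ᵐ x ∂μ, ∀ᵐ y ∂ν, g x y ≤ eLpNorm (fun x => g x y) ⊤ μ :=
      (Measure.ae_ae_comm (p := fun x y => g x y ≤ eLpNorm (fun x => g x y) ⊤ μ)
        (measurableSet_le hg (hN.comp measurable_snd))).2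
        (Filter.Eventually.of_forall fun y => eLpNorm_top_le_iff_ae_le.1 le_rfl)
    exact eLpNorm_top_le_iff_ae_le.2 (hle.mono fun x hx => lintegral_mono_ae hx)
  rcases hp.eq_or_lt with rfl | hp1
  · simp only [eLpNorm_one_eq_lintegral_enorm, enorm_eq_self]
    exact (lintegral_lintegral_swap hg.aemeasurable).le
  · have hp0 : p ≠ 0 := (one_pos.trans hp1).ne'
    rw [eLpNorm_ennreal_eq_lintegral_rpow hp0 hp', one_div,
      ENNReal.rpow_inv_le_iff (ENNReal.toReal_pos hp0 hp')]
    exact lintegral_rpow_lintegral_le hg hp1 hp'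

theorem exists_lintegral_le_eLpNorm_mul {κ : Measure α} [IsFiniteMeasure κ] (hκ : κ ≤ μ)
    {p : ℝ≥0∞} (hp : 1 ≤ p) :
    ∃ C : ℝ≥0∞, C ≠ ⊤ ∧ ∀ f : α → ℝ≥0∞, Measurable f → ∫⁻ x, f x ∂κ ≤ eLpNorm f p μ * C := by
  have h_exponent : 0 ≤ 1 / (1 : ℝ≥0∞).toReal - 1 / p.toReal := by
    rcases eq_or_ne p ⊤ with rfl | hp'
    · simp
    · rw [ENNReal.toReal_one, div_one, sub_nonneg]
      exact div_le_one_of_le₀ (by simpa using ENNReal.toReal_mono hp' hp) ENNReal.toReal_nonneg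
  refine ⟨_, ENNReal.rpow_ne_top_of_nonneg h_exponent (measure_ne_top κ Set.univ), fun f hf => ?_⟩
  calc ∫⁻ x, f x ∂κ = eLpNorm f 1 κ := by simp only [eLpNorm_one_eq_lintegral_enorm, enorm_eq_self]
    _ ≤ eLpNorm f p κ * _ := eLpNorm_le_eLpNorm_mul_rpow_measure_univ hp hf.aestronglyMeasurable
    _ ≤ eLpNorm f p μ * _ := by gcongr

theorem lintegral_prod_lt_top_of_eLpNorm_eLpNorm_lt_top [SFinite μ] {κ : Measure α}
    {κ' : Measure β} [IsFiniteMeasure κ] [IsFiniteMeasure κ'] (hκ : κ ≤ μ) (hκ' : κ' ≤ ν)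
    {u : α → β → ℝ≥0∞} (hu : Measurable (Function.uncurry u)) {p q : ℝ≥0∞} (hp : 1 ≤ p)
    (hq : 1 ≤ q) (hfin : eLpNorm (fun y => eLpNorm (fun x => u x y) p μ) q ν < ⊤) :
    ∫⁻ z, u z.1 z.2 ∂κ.prod κ' < ⊤ := by
  obtain ⟨C, hC_top, hC⟩ := exists_lintegral_le_eLpNorm_mul hκ hp
  obtain ⟨C', hC'_top, hC'⟩ := exists_lintegral_le_eLpNorm_mul hκ' hq
  have hN := measurable_eLpNorm_left (μ := μ) hu p
  calc ∫⁻ z, u z.1 z.2 ∂κ.prod κ' = ∫⁻ y, ∫⁻ x, u x y ∂κ ∂κ' :=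
        lintegral_prod_symm _ hu.aemeasurable
    _ ≤ ∫⁻ y, eLpNorm (fun x => u x y) p μ * C ∂κ' :=
        lintegral_mono fun y => hC _ (hu.comp measurable_prodMk_right)
    _ = (∫⁻ y, eLpNorm (fun x => u x y) p μ ∂κ') * C := lintegral_mul_const _ hN
    _ ≤ eLpNorm (fun y => eLpNorm (fun x => u x y) p μ) q ν * C' * C := by gcongr; exact hC' _ hN
    _ < ⊤ := ENNReal.mul_lt_top (ENNReal.mul_lt_top hfin hC'_top.lt_top) hC_top.lt_top

end Minkowski

section Young

variable {G H : Type*} [AddMonoid G] [MeasurableSpace G] [MeasurableAdd₂ G]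
  [AddMonoid H] [MeasurableSpace H] [MeasurableAdd₂ H]
  {μ : Measure G} {ν : Measure H} [SFinite μ] [SFinite ν]
  [μ.IsAddRightInvariant] [ν.IsAddRightInvariant]

theorem eLpNorm_eLpNorm_lintegral_add_le (κ : Measure (G × H)) [SFinite κ] {u : G → H → ℝ≥0∞}
    (hu : Measurable (Function.uncurry u)) {p q : ℝ≥0∞} (hp : 1 ≤ p) (hq : 1 ≤ q) :
    eLpNorm (fun ξ => eLpNorm (fun x => ∫⁻ z, u (x + z.1) (ξ + z.2) ∂κ) p μ) q ν ≤
      κ Set.univ * eLpNorm (fun ξ => eLpNorm (fun x => u x ξ) p μ) q ν := by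
  have hU : Measurable fun ξ => eLpNorm (fun x => u x ξ) p μ := measurable_eLpNorm_left hu p
  have hinner : ∀ ξ, eLpNorm (fun x => ∫⁻ z, u (x + z.1) (ξ + z.2) ∂κ) p μ ≤
      ∫⁻ z, eLpNorm (fun x => u x (ξ + z.2)) p μ ∂κ := by
    intro ξ
    refine (eLpNorm_lintegral_le (g := fun x (z : G × H) => u (x + z.1) (ξ + z.2)) ?_ hp).trans_eq
      (lintegral_congr fun z => ?_)
    · exact hu.comp (f := fun w : G × G × H => (w.1 + w.2.1, ξ + w.2.2))
        ((measurable_fst.add measurable_snd.fst).prodMk (measurable_snd.snd.const_add ξ))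
    · exact eLpNorm_comp_measurePreserving (g := fun x => u x (ξ + z.2))
        (hu.comp measurable_prodMk_right).aestronglyMeasurable (measurePreserving_add_right μ z.1)
  calc eLpNorm (fun ξ => eLpNorm (fun x => ∫⁻ z, u (x + z.1) (ξ + z.2) ∂κ) p μ) q ν
      ≤ eLpNorm (fun ξ => ∫⁻ z, eLpNorm (fun x => u x (ξ + z.2)) p μ ∂κ) q ν :=
        eLpNorm_mono_enorm fun ξ => hinner ξ
    _ ≤ ∫⁻ z, eLpNorm (fun ξ => eLpNorm (fun x => u x (ξ + z.2)) p μ) q ν ∂κ :=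
        eLpNorm_lintegral_le (g := fun ξ (z : G × H) => eLpNorm (fun x => u x (ξ + z.2)) p μ)
          (hU.comp (measurable_fst.add measurable_snd.snd)) hq
    _ = ∫⁻ _, eLpNorm (fun ξ => eLpNorm (fun x => u x ξ) p μ) q ν ∂κ :=
        lintegral_congr fun z => eLpNorm_comp_measurePreserving
          (g := fun ξ => eLpNorm (fun x => u x ξ) p μ) hU.aestronglyMeasurable
          (measurePreserving_add_right ν z.2)
    _ = _ := by rw [lintegral_const, mul_comm]

end Young

/-! ### Multipliers of `𝒦₁` -/

section Multipliers

variable {E : Type*} [NormedAddCommGroup E] [NormedSpace ℝ E] {M : E →L[ℝ] ℂ}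

theorem norm_iteratedFDeriv_succ_comp_clm_le {f f' : ℂ → ℂ} (hf : ∀ w, HasDerivAt f (f' w) w)
    (hf' : ContDiff ℝ ∞ f') (M : E →L[ℝ] ℂ) (j : ℕ) (t : E) :
    ‖iteratedFDeriv ℝ (j + 1) (fun s => f (M s)) t‖ ≤
      ‖M‖ * ‖iteratedFDeriv ℝ j (fun s => f' (M s)) t‖ := by
  set A : ℂ →L[ℝ] E →L[ℝ] ℂ := (ContinuousLinearMap.lsmul ℝ ℂ).flip M
  have hA : ‖A‖ ≤ ‖M‖ := ContinuousLinearMap.opNorm_le_bound _ (norm_nonneg _) fun c => by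
    simp only [A, ContinuousLinearMap.flip_apply, ContinuousLinearMap.lsmul_apply, norm_smul,
      mul_comm, le_refl]
  have h_fderiv : fderiv ℝ (fun s => f (M s)) = A ∘ fun s => f' (M s) := funext fun s =>
    ((hf (M s)).comp_hasFDerivAt_of_eq s M.hasFDerivAt rfl).fderiv
  rw [← norm_iteratedFDeriv_fderiv, h_fderiv]
  refine (A.norm_iteratedFDeriv_comp_left (N := ∞) (hf'.comp M.contDiff).contDiffAt
    (by exact_mod_cast le_top)).trans ?_
  gcongr
  rfl

theorem norm_iteratedFDeriv_cexp_clm_le (M : E →L[ℝ] ℂ) (j : ℕ) (t : E) :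
    ‖iteratedFDeriv ℝ j (fun s => Complex.exp (M s)) t‖ ≤ ‖M‖ ^ j * Real.exp (‖M‖ * ‖t‖) := by
  induction j with
  | zero =>
    rw [norm_iteratedFDeriv_zero, Complex.norm_exp, pow_zero, one_mul, Real.exp_le_exp]
    exact (Complex.re_le_norm _).trans (M.le_opNorm t)
  | succ j ih =>
    refine (norm_iteratedFDeriv_succ_comp_clm_le Complex.hasDerivAt_exp Complex.contDiff_exp
      M j t).trans ?_
    rw [pow_succ', mul_assoc]
    gcongr

/-- The remainder of the Taylor polynomial of `exp` with `r` terms, which is of order `r` at `0`. -/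
def expRemainder (r : ℕ) (w : ℂ) : ℂ := Complex.exp w - ∑ i ∈ Finset.range r, w ^ i / i.factorial

theorem expRemainder_two (w : ℂ) : expRemainder 2 w = Complex.exp w - 1 - w := by
  simp [expRemainder, Finset.sum_range_succ, sub_sub]

theorem hasDerivAt_expRemainder_succ (r : ℕ) (w : ℂ) :
    HasDerivAt (expRemainder (r + 1)) (expRemainder r w) w := by
  unfold expRemainder
  simp only [Finset.sum_range_succ', pow_zero]
  refine (Complex.hasDerivAt_exp w).sub (HasDerivAt.add_const _ (HasDerivAt.fun_sum fun i _ => ?_))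
  have h_factorial : ((i + 1).factorial : ℂ) = (i + 1) * i.factorial := by
    push_cast [Nat.factorial_succ]; rfl
  refine ((hasDerivAt_pow (i + 1) w).div_const ((i + 1).factorial : ℂ)).congr_deriv ?_
  rw [h_factorial, Nat.add_sub_cancel, Nat.cast_succ, mul_div_mul_left _ _ i.cast_add_one_ne_zero]

theorem contDiff_expRemainder (r : ℕ) : ContDiff ℝ ∞ (expRemainder r) := by
  unfold expRemainder
  exact Complex.contDiff_exp.sub (ContDiff.sum fun i _ => (contDiff_id.pow i).div_const _)

theorem norm_iteratedFDeriv_expRemainder_clm_le (hM : ‖M‖ ≤ 1) (r j : ℕ) (t : E) :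
    ‖iteratedFDeriv ℝ j (fun s => expRemainder r (M s)) t‖ ≤
      ‖M‖ ^ r * Real.exp ((r + 1 : ℕ) * ‖t‖) := by
  have hMt : ‖M t‖ ≤ ‖t‖ := M.le_of_opNorm_le hM t |>.trans_eq (one_mul _)
  induction j generalizing r with
  | zero =>
    rw [norm_iteratedFDeriv_zero]
    calc ‖expRemainder r (M t)‖ ≤ ‖M t‖ ^ r * Real.exp ‖M t‖ :=
          Complex.norm_exp_sub_sum_le_norm_mul_exp _ r
      _ ≤ (‖M‖ * Real.exp ‖t‖) ^ r * Real.exp ‖t‖ := by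
          gcongr
          exact (M.le_opNorm t).trans (by gcongr; linarith [Real.add_one_le_exp ‖t‖])
      _ = ‖M‖ ^ r * Real.exp ((r + 1 : ℕ) * ‖t‖) := by
          rw [Real.exp_nat_mul]; ring
  | succ j ih =>
    rcases r with - | r
    · simp only [expRemainder, Finset.sum_range_zero, sub_zero]
      refine (norm_iteratedFDeriv_cexp_clm_le M (j + 1) t).trans ?_
      rw [pow_zero, zero_add, Nat.cast_one]
      gcongr
      exact pow_le_one₀ (norm_nonneg _) hM
    · calc ‖iteratedFDeriv ℝ (j + 1) (fun s => expRemainder (r + 1) (M s)) t‖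
          ≤ ‖M‖ * (‖M‖ ^ r * Real.exp ((r + 1 : ℕ) * ‖t‖)) :=
            (norm_iteratedFDeriv_succ_comp_clm_le (hasDerivAt_expRemainder_succ r)
              (contDiff_expRemainder r) M j t).trans (by gcongr; exact ih r)
        _ ≤ ‖M‖ ^ (r + 1) * Real.exp ((r + 1 + 1 : ℕ) * ‖t‖) := by
            rw [pow_succ', mul_assoc]
            gcongr
            lia

/-- Smooth functions all of whose derivatives grow at most exponentially: the multipliers of
`𝒦₁`. -/
structure HasExpGrowth (g : E → ℂ) : Prop where
  contDiff : ContDiff ℝ ∞ g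
  exists_norm_le : ∀ j : ℕ, ∃ (κ : ℕ) (B : ℝ),
    ∀ t, ‖iteratedFDeriv ℝ j g t‖ ≤ B * Real.exp (κ * ‖t‖)

theorem hasExpGrowth_cexp_clm (M : E →L[ℝ] ℂ) : HasExpGrowth fun t => Complex.exp (M t) := by
  refine ⟨Complex.contDiff_exp.comp M.contDiff, fun j => ?_⟩
  obtain ⟨κ, hκ⟩ := exists_nat_ge ‖M‖
  refine ⟨κ, ‖M‖ ^ j, fun t => (norm_iteratedFDeriv_cexp_clm_le M j t).trans ?_⟩
  gcongr

theorem hasExpGrowth_clm (M : E →L[ℝ] ℂ) : HasExpGrowth M := by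
  refine ⟨M.contDiff, fun j => ?_⟩
  obtain ⟨κ, B, hB⟩ := M.hasTemperateGrowth.2 j
  refine ⟨κ, B, fun t => (hB t).trans ?_⟩
  have hB0 : 0 ≤ B := by simpa using (norm_nonneg _).trans (hB 0)
  rw [Real.exp_nat_mul]
  gcongr
  linarith [Real.add_one_le_exp ‖t‖]

end Multipliers

namespace K1

variable {n : ℕ}

theorem exp_mul_norm_iteratedFDeriv_mul_le (χ : K1 n) {g : RSpace n → ℂ} (hg : ContDiff ℝ ∞ g)
    {κ : ℕ → ℕ} {B : ℕ → ℝ} {j : ℕ}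
    (hB : ∀ i ≤ j, ∀ t, ‖iteratedFDeriv ℝ i g t‖ ≤ B i * Real.exp (κ i * ‖t‖)) (k : ℕ)
    (t : RSpace n) :
    Real.exp (k * ‖t‖) * ‖iteratedFDeriv ℝ j (fun s => g s * χ s) t‖ ≤
      ∑ i ∈ Finset.range (j + 1), j.choose i * (B i * seminormFamily n (k + κ i, j - i) χ) := by
  have h_leibniz := norm_iteratedFDeriv_mul_le hg χ.contDiff t (n := j) (by exact_mod_cast le_top)
  refine (mul_le_mul_of_nonneg_left h_leibniz (Real.exp_pos _).le).trans ?_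
  rw [Finset.mul_sum]
  refine Finset.sum_le_sum fun i hi => ?_
  have h_bound := hB i (Finset.mem_range_succ_iff.1 hi) t
  have hB0 : 0 ≤ B i := nonneg_of_mul_nonneg_left ((norm_nonneg _).trans h_bound) (Real.exp_pos _)
  have h_exp : Real.exp ((k + κ i : ℕ) * ‖t‖) = Real.exp (k * ‖t‖) * Real.exp (κ i * ‖t‖) := by
    rw [← Real.exp_add]; push_cast; ring_nf
  calc Real.exp (k * ‖t‖) * (j.choose i * ‖iteratedFDeriv ℝ i g t‖ * ‖iteratedFDeriv ℝ (j - i) χ t‖)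
      ≤ Real.exp (k * ‖t‖) * (j.choose i * (B i * Real.exp (κ i * ‖t‖)) *
          ‖iteratedFDeriv ℝ (j - i) χ t‖) := by
        gcongr
    _ = j.choose i * (B i * (Real.exp ((k + κ i : ℕ) * ‖t‖) * ‖iteratedFDeriv ℝ (j - i) χ t‖)) := by
        rw [h_exp]; ring
    _ ≤ _ := by
        gcongr
        exact le_seminorm χ _ _ t

/-- The product of a multiplier and an element of `𝒦₁`. -/
def mul (g : RSpace n → ℂ) (hg : HasExpGrowth g) (χ : K1 n) : K1 n :=
  ⟨fun t => g t * χ t, hg.contDiff.mul χ.contDiff, fun k j => by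
    choose κ B hB using hg.exists_norm_le
    exact ⟨_, exp_mul_norm_iteratedFDeriv_mul_le χ hg.contDiff (fun i _ => hB i) k⟩⟩

theorem sumSeminorm_le_of_eq_mul {χ χ' : K1 n} {g : RSpace n → ℂ} (hg : ContDiff ℝ ∞ g)
    (h : ∀ t, χ' t = g t * χ t) {κ N : ℕ} {B : ℝ}
    (hB : ∀ i ≤ N, ∀ t, ‖iteratedFDeriv ℝ i g t‖ ≤ B * Real.exp (κ * ‖t‖)) (k : ℕ) :
    sumSeminorm k N χ' ≤ B * 2 ^ (N + 1) * sumSeminorm (k + κ) N χ := by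
  set S := sumSeminorm (k + κ) N χ
  have hB0 : 0 ≤ B :=
    nonneg_of_mul_nonneg_left ((norm_nonneg _).trans (hB 0 N.zero_le 0)) (Real.exp_pos _)
  have h_seminorm (j) (hj : j ≤ N) : seminormFamily n (k, j) χ' ≤ B * 2 ^ j * S := by
    refine seminorm_le χ' k j fun t => ?_
    have h_fun : (χ' : RSpace n → ℂ) = fun s => g s * χ s := funext h
    rw [h_fun]
    refine (exp_mul_norm_iteratedFDeriv_mul_le χ hg (κ := fun _ => κ) (B := fun _ => B)
      (fun i hi => hB i (hi.trans hj)) k t).trans ?_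
    calc ∑ i ∈ Finset.range (j + 1), j.choose i * (B * seminormFamily n (k + κ, j - i) χ)
        ≤ ∑ i ∈ Finset.range (j + 1), j.choose i * (B * S) := by
          gcongr with i
          exact seminorm_le_sumSeminorm _ _ χ ((j.sub_le i).trans hj)
      _ = B * 2 ^ j * S := by
          rw [← Finset.sum_mul, ← Nat.cast_sum, Nat.sum_range_choose]
          push_cast
          ring
  calc sumSeminorm k N χ' ≤ ∑ j ∈ Finset.range (N + 1), B * 2 ^ j * S :=
        Finset.sum_le_sum fun j hj => h_seminorm j (Finset.mem_range_succ_iff.1 hj)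
    _ = B * (2 ^ (N + 1) - 1) * S := by
        rw [← Finset.sum_mul, ← Finset.mul_sum, geom_sum_eq (by norm_num)]
        norm_num
    _ ≤ B * 2 ^ (N + 1) * S := by
        gcongr
        · exact sumSeminorm_nonneg _ _ _
        · linarith

end K1

/-! ### Holomorphy of the short-time Fourier transform -/

section Holomorphy

variable {n : ℕ}

theorem expForm_apply (z : Fin n → ℂ) (t : RSpace n) :
    expForm z t = -2 * Real.pi * Complex.I * cdot z t := rfl

theorem cdot_add (z h : Fin n → ℂ) (t : RSpace n) : cdot (z + h) t = cdot z t + cdot h t := by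
  simp only [cdot, Pi.add_apply, add_mul, Finset.sum_add_distrib]

theorem cdot_smul (c : ℂ) (z : Fin n → ℂ) (t : RSpace n) : cdot (c • z) t = c * cdot z t := by
  simp only [cdot, Pi.smul_apply, smul_eq_mul, mul_assoc, Finset.mul_sum]

theorem norm_expForm_le (z : Fin n → ℂ) : ‖expForm z‖ ≤ 2 * Real.pi * n * ‖z‖ := by
  refine ContinuousLinearMap.opNorm_le_bound _ (by positivity) fun t => ?_
  have h_cdot : ‖cdot z t‖ ≤ n * (‖z‖ * ‖t‖) := calc
    ‖cdot z t‖ ≤ ∑ _j : Fin n, ‖z‖ * ‖t‖ := norm_sum_le_of_le _ fun j _ => by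
      rw [norm_mul, Complex.norm_real]
      exact mul_le_mul (norm_le_pi_norm z j) (PiLp.norm_apply_le t j) (norm_nonneg _)
        (norm_nonneg _)
    _ = n * (‖z‖ * ‖t‖) := by simp
  have h_const : ‖-2 * (Real.pi : ℂ) * Complex.I‖ = 2 * Real.pi := by
    simp [abs_of_pos Real.pi_pos]
  rw [expForm_apply, norm_mul, h_const]
  linarith [mul_le_mul_of_nonneg_left h_cdot Real.two_pi_pos.le]

theorem timeFreqFun_add (ψ : RSpace n → ℂ) (x : RSpace n) (z h : Fin n → ℂ) (t : RSpace n) :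
    timeFreqFun ψ x (z + h) t = Complex.exp (expForm h t) * timeFreqFun ψ x z t := by
  rw [timeFreqFun, timeFreqFun, expForm_apply, ← mul_assoc, ← Complex.exp_add, cdot_add]
  ring_nf

/-- The function `t ↦ e^{-2πi z·t} conj (ψ (t - x))` as an element of `𝒦₁`. -/
def K1.timeFreq (ψ : K1 n) (x : RSpace n) (z : Fin n → ℂ) : K1 n :=
  ⟨timeFreqFun ψ x z, timeFreqFun_mem_k1 ψ.2 x z⟩

/-- The derivative of `z ↦ V_ψ F(x, z)`, obtained by differentiating under the dual pairing:
`h ↦ ⟨F, (-2πi h·t) e^{-2πi z·t} conj (ψ (t - x))⟩`. -/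
def stftDeriv (ψ : K1 n) (F : K1Dual n) (x : RSpace n) (z : Fin n → ℂ) : (Fin n → ℂ) →L[ℂ] ℂ :=
  LinearMap.toContinuousLinearMap
    { toFun := fun h => F ((ψ.timeFreq x z).mul (expForm h) (hasExpGrowth_clm _))
      map_add' := fun h h' => by
        rw [← map_add]
        congr 1
        refine Subtype.ext (funext fun t => ?_)
        change expForm (h + h') t * _ = expForm h t * _ + expForm h' t * _
        rw [expForm_apply, cdot_add, mul_add, add_mul]
        rfl
      map_smul' := fun c h => by
        rw [← map_smul]
        congr 1
        refine Subtype.ext (funext fun t => ?_)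
        change expForm (c • h) t * _ = c * (expForm h t * _)
        rw [expForm_apply, expForm_apply, cdot_smul]
        ring }

theorem exists_norm_stft_sub_sub_stftDeriv_le (ψ : K1 n) (F : K1Dual n) (x : RSpace n)
    (z : Fin n → ℂ) : ∃ C, ∀ h, ‖expForm h‖ ≤ 1 →
      ‖stft ψ F x (z + h) - stft ψ F x z - stftDeriv ψ F x z h‖ ≤ C * ‖h‖ ^ 2 := by
  obtain ⟨k, N, C, hC0, hC⟩ := K1.exists_norm_le_sumSeminorm F
  set b := ψ.timeFreq x z
  set S := 2 ^ (N + 1) * K1.sumSeminorm (k + 3) N b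
  have hS : 0 ≤ S := mul_nonneg (by positivity) (K1.sumSeminorm_nonneg _ _ _)
  refine ⟨C * ((2 * Real.pi * n) ^ 2 * S), fun h hh => ?_⟩
  set u := ψ.timeFreq x (z + h) - b - b.mul (expForm h) (hasExpGrowth_clm _)
  have hu_apply (t) : u t = expRemainder 2 (expForm h t) * b t := by
    change timeFreqFun ψ x (z + h) t - timeFreqFun ψ x z t - expForm h t * timeFreqFun ψ x z t =
      expRemainder 2 (expForm h t) * timeFreqFun ψ x z t
    rw [timeFreqFun_add, expRemainder_two]
    ring
  have hu : K1.sumSeminorm k N u ≤ ‖expForm h‖ ^ 2 * S :=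
    (K1.sumSeminorm_le_of_eq_mul ((contDiff_expRemainder 2).comp (expForm h).contDiff) hu_apply
      (fun i _ => norm_iteratedFDeriv_expRemainder_clm_le hh 2 i) k).trans_eq (mul_assoc _ _ _)
  have h_stft : stft ψ F x (z + h) - stft ψ F x z - stftDeriv ψ F x z h = F u := by
    rw [map_sub, map_sub]
    rfl
  calc ‖stft ψ F x (z + h) - stft ψ F x z - stftDeriv ψ F x z h‖
      ≤ C * (‖expForm h‖ ^ 2 * S) := by
        rw [h_stft]
        exact (hC u).trans (by gcongr)
    _ ≤ C * ((2 * Real.pi * n * ‖h‖) ^ 2 * S) := by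
        gcongr
        exact norm_expForm_le h
    _ = C * ((2 * Real.pi * n) ^ 2 * S) * ‖h‖ ^ 2 := by ring

open Filter Topology in
theorem hasFDerivAt_stft (ψ : K1 n) (F : K1Dual n) (x : RSpace n) (z : Fin n → ℂ) :
    HasFDerivAt (stft ψ F x) (stftDeriv ψ F x z) z := by
  obtain ⟨C, hC⟩ := exists_norm_stft_sub_sub_stftDeriv_le ψ F x z
  rw [hasFDerivAt_iff_isLittleO_nhds_zero]
  have h_tendsto : Tendsto (fun h : Fin n → ℂ => 2 * Real.pi * n * ‖h‖) (𝓝 0) (𝓝 0) :=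
    Continuous.tendsto' (by fun_prop) _ _ (by simp)
  have h_small : ∀ᶠ h : Fin n → ℂ in 𝓝 0, ‖expForm h‖ ≤ 1 :=
    (h_tendsto.eventually (gt_mem_nhds one_pos)).mono fun h hh => (norm_expForm_le h).trans hh.le
  refine Asymptotics.IsBigO.trans_isLittleO (.of_bound C (h_small.mono fun h hh => ?_))
    (Asymptotics.isLittleO_norm_pow_id one_lt_two)
  simpa using hC h hh

theorem differentiable_stft (ψ : K1 n) (F : K1Dual n) (x : RSpace n) :
    Differentiable ℂ (stft ψ F x) :=
  fun z => (hasFDerivAt_stft ψ F x z).differentiableAt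

end Holomorphy

/-! ### Time-frequency covariance -/

section Covariance

variable {E : Type*} [NormedAddCommGroup E] [InnerProductSpace ℝ E] [FiniteDimensional ℝ E]
  [MeasurableSpace E] [BorelSpace E]

theorem norm_gaborCoeff_gaborAtom (φ χ : E → ℂ) (p q : E × E) :
    ‖gaborCoeff φ (gaborAtom χ p) q‖ = ‖gaborCoeff φ (fun t => conj (χ t)) (q - p)‖ := by
  have h_shift : gaborCoeff φ (gaborAtom χ p) q =
      𝐞 (inner ℝ p.1 (q.2 - p.2)) • gaborCoeff φ (fun t => conj (χ t)) (q - p) := by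
    rw [gaborCoeff, gaborCoeff, ← integral_add_right_eq_self _ p.1, Circle.smul_def,
      ← integral_smul]
    congr 1 with s
    have h_phase : 𝐞 (-inner ℝ (s + p.1) p.2) * 𝐞 (inner ℝ (s + p.1) q.2) =
        𝐞 (inner ℝ p.1 (q.2 - p.2)) * 𝐞 (inner ℝ s (q.2 - p.2)) := by
      rw [← AddChar.map_add_eq_mul, ← AddChar.map_add_eq_mul]
      congr 1
      simp only [inner_add_left, inner_sub_right]
      ring
    have h_arg : s + p.1 - q.1 = s - (q.1 - p.1) := by abel
    replace h_phase := congrArg ((↑) : Circle → ℂ) h_phase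
    simp only [gaborAtom, conj_fourierChar_smul, neg_neg, Complex.conj_conj, Prod.fst_sub,
      Prod.snd_sub, add_sub_cancel_right, h_arg]
    simp only [Circle.smul_def, smul_eq_mul]
    push_cast at h_phase
    linear_combination (conj (χ s) * φ (s - (q.1 - p.1))) * h_phase
  rw [h_shift, Circle.norm_smul]

variable {ρ : E → ℝ} {φ χ χ' : E → ℂ}

theorem gaborCoeff_add (hφ : Rapid ρ φ) (hχ : Integrable χ) (hχ' : Integrable χ') (p : E × E) :
    gaborCoeff φ (χ + χ') p = gaborCoeff φ χ p + gaborCoeff φ χ' p := by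
  obtain ⟨C, hC⟩ := hφ.exists_norm_le
  have hi {f : E → ℂ} (hf : Integrable f) : Integrable fun s => f s * conj (gaborAtom φ p s) :=
    hf.mul_bdd (c := C)
      (Complex.continuous_conj.comp (continuous_gaborAtom hφ.continuous p)).aestronglyMeasurable
      (.of_forall fun s => by simpa only [RCLike.norm_conj, norm_gaborAtom] using hC (s - p.1))
  simp only [gaborCoeff, Pi.add_apply, add_mul]
  exact integral_add (hi hχ) (hi hχ')

theorem gaborCoeff_smul (φ χ : E → ℂ) (c : ℂ) (p : E × E) :
    gaborCoeff φ (c • χ) p = c * gaborCoeff φ χ p := by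
  simp only [gaborCoeff, Pi.smul_apply, smul_eq_mul, mul_assoc, integral_const_mul]

end Covariance

section RSpace

variable {n : ℕ}

theorem cdot_ofReal (ξ t : RSpace n) : cdot (fun j => (ξ j : ℂ)) t = inner ℝ t ξ := by
  simp [cdot, PiLp.inner_apply]

theorem timeFreqFun_ofReal (φ : RSpace n → ℂ) (x ξ : RSpace n) :
    timeFreqFun φ x (fun j => (ξ j : ℂ)) = gaborAtom φ (x, ξ) := by
  ext t
  rw [timeFreqFun, cdot_ofReal, gaborAtom, Circle.smul_def, Real.fourierChar_apply, smul_eq_mul]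
  push_cast
  ring_nf

theorem cdot_complexPoint (ξ η t : RSpace n) :
    cdot (complexPoint ξ η) t = inner ℝ t ξ + inner ℝ t η * Complex.I := by
  simp only [← cdot_ofReal, cdot, complexPoint, Finset.sum_mul, ← Finset.sum_add_distrib]
  exact Finset.sum_congr rfl fun j _ => by ring

theorem norm_complexPoint_zero_le (η : RSpace n) : ‖complexPoint 0 η‖ ≤ ‖η‖ :=
  (pi_norm_le_iff_of_nonneg (norm_nonneg η)).2 fun j => by
    simpa [complexPoint] using PiLp.norm_apply_le η j

end RSpace

namespace K1

variable {n : ℕ}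

theorem norm_iteratedFDeriv_conj (χ : K1 n) (j : ℕ) (t : RSpace n) :
    ‖iteratedFDeriv ℝ j (fun s => conj (χ s)) t‖ = ‖iteratedFDeriv ℝ j χ t‖ :=
  Complex.conjLIE.norm_iteratedFDeriv_comp_left χ t j

/-- The complex conjugate of an element of `𝒦₁`. -/
def conjugate (χ : K1 n) : K1 n :=
  ⟨fun t => conj (χ t), Complex.conjCLE.contDiff.comp χ.contDiff, fun k j => ⟨_, fun t => by
    rw [norm_iteratedFDeriv_conj]
    exact χ.le_seminorm k j t⟩⟩

theorem sumSeminorm_conjugate (k N : ℕ) (χ : K1 n) :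
    sumSeminorm k N χ.conjugate = sumSeminorm k N χ := by
  refine Finset.sum_congr rfl fun j _ => ?_
  change (⨆ t, _ * ‖iteratedFDeriv ℝ j (fun s => conj (χ s)) t‖) = _
  simp only [norm_iteratedFDeriv_conj]
  rfl

/-- The window `t ↦ e^{2π t·η} ψ(t)`. -/
def tilt (ψ : K1 n) (η : RSpace n) : K1 n :=
  ψ.mul (fun t => Complex.exp (expForm (complexPoint 0 η) t)) (hasExpGrowth_cexp_clm _)

theorem exists_sumSeminorm_tilt_le (ψ : K1 n) (lam : ℝ) (k N : ℕ) :
    ∃ C, ∀ η : RSpace n, ‖η‖ ≤ lam → sumSeminorm k N (ψ.tilt η) ≤ C := by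
  set R := 2 * Real.pi * n * lam
  obtain ⟨κ, hκ⟩ := exists_nat_ge R
  refine ⟨(1 + R) ^ N * 2 ^ (N + 1) * sumSeminorm (k + κ) N ψ, fun η hη =>
    sumSeminorm_le_of_eq_mul (hasExpGrowth_cexp_clm _).contDiff (fun _ => rfl)
      (fun i hi t => (norm_iteratedFDeriv_cexp_clm_le _ i t).trans ?_) k⟩
  have h_norm : ‖expForm (complexPoint 0 η)‖ ≤ R :=
    (norm_expForm_le _).trans (mul_le_mul_of_nonneg_left
      ((norm_complexPoint_zero_le η).trans hη) (by positivity))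
  have hR : 0 ≤ R := (norm_nonneg _).trans h_norm
  gcongr
  · calc ‖expForm (complexPoint 0 η)‖ ^ i ≤ (1 + R) ^ i := by gcongr; linarith
      _ ≤ (1 + R) ^ N := pow_le_pow_right₀ (by linarith) hi
  · exact h_norm.trans hκ

end K1

theorem exp_mul_stft_complexPoint {n : ℕ} (ψ : K1 n) (F : K1Dual n) (x ξ η : RSpace n) :
    (Real.exp (-2 * Real.pi * inner ℝ x η) : ℂ) * stft ψ F x (complexPoint ξ η) =
      stft (ψ.tilt η) F x (fun j => (ξ j : ℂ)) := by
  refine (F.map_smul _ _).symm.trans (congrArg F (Subtype.ext (funext fun t => ?_)))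
  change (Real.exp (-2 * Real.pi * inner ℝ x η) : ℂ) *
      (Complex.exp (-2 * Real.pi * Complex.I * cdot (complexPoint ξ η) t) * conj (ψ (t - x))) =
    Complex.exp (-2 * Real.pi * Complex.I * cdot (fun j => (ξ j : ℂ)) t) *
      conj (Complex.exp (expForm (complexPoint 0 η) (t - x)) * ψ (t - x))
  rw [expForm_apply, map_mul, ← Complex.exp_conj, cdot_complexPoint, cdot_complexPoint,
    cdot_ofReal, Complex.ofReal_exp, ← mul_assoc, ← mul_assoc, ← Complex.exp_add,
    ← Complex.exp_add]
  congr 2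
  simp only [inner_sub_left, inner_zero_right, map_mul, map_add, map_neg, map_ofNat,
    Complex.conj_I, Complex.conj_ofReal]
  push_cast
  linear_combination (-2 * Real.pi * (inner ℝ x η : ℝ) : ℂ) * Complex.I_sq

/-! ### The reproducing formula for distributions -/

section Reproducing

variable {n : ℕ}

theorem K1.exists_sumSeminorm_le_norm_weightedPair (n k N : ℕ) : ∃ (k' : ℕ) (C : ℝ),
    ∀ χ : K1 n, sumSeminorm k N χ ≤
      C * ‖weightedPair isBaseWeight_exp_norm isBaseWeight_one_add_norm k' χ.biRapid‖ := by
  choose K C _ hC using fun j => exists_exp_mul_norm_iteratedFDeriv_le (RSpace n) j k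
  refine ⟨(Finset.range (N + 1)).sup K, ∑ j ∈ Finset.range (N + 1), C j, fun χ => ?_⟩
  obtain ⟨h_time, h_freq⟩ := (norm_weightedPair_le_iff isBaseWeight_exp_norm
    isBaseWeight_one_add_norm χ.biRapid (k := (Finset.range (N + 1)).sup K)).1 le_rfl
  rw [sumSeminorm, Finset.sum_mul]
  refine Finset.sum_le_sum fun j hj => seminorm_le χ k j (hC j χ χ.biRapid _ ?_ ?_)
  · refine fun t => le_trans ?_ (h_time t)
    gcongr
    exacts [isBaseWeight_exp_norm.one_le t, Finset.le_sup hj]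
  · refine fun ξ => le_trans ?_ (h_freq ξ)
    gcongr
    exacts [isBaseWeight_one_add_norm.one_le ξ, Finset.le_sup hj]

theorem K1.reproducing_formula (g : K1 n) (F : K1Dual n) :
    Continuous (fun p : RSpace n × RSpace n => stft g F p.1 (fun j => (p.2 j : ℂ))) ∧
    ∀ χ : K1 n,
      Integrable (fun p => gaborCoeff g χ p * stft g F p.1 (fun j => (p.2 j : ℂ))) ∧
      ∫ p, gaborCoeff g χ p * stft g F p.1 (fun j => (p.2 j : ℂ)) =
        (∫ s, g s * conj (g s)) * F χ := by
  obtain ⟨k, N, C, hC0, hC⟩ := exists_norm_le_sumSeminorm F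
  obtain ⟨k', C', hC'⟩ := exists_sumSeminorm_le_norm_weightedPair n k N
  refine weak_reproducing_formula isBaseWeight_exp_norm isBaseWeight_one_add_norm k'
    (k1Submodule n).subtype K1.biRapid g.biRapid
    (fun p => g.timeFreq p.1 (fun j => (p.2 j : ℂ)))
    (fun p => timeFreqFun_ofReal g p.1 p.2) F.toLinearMap (C * C') fun χ => (hC χ).trans ?_
  rw [mul_assoc]
  exact mul_le_mul_of_nonneg_left (hC' χ) hC0

namespace GelfandShilov

theorem biRapid (φ : GelfandShilov n) :
    BiRapid (fun t => Real.exp ‖t‖) (fun ξ => Real.exp ‖ξ‖) φ := by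
  obtain ⟨⟨Φ, hΦ, hΦ_ext⟩, h_time, h_freq⟩ := φ.2
  simp only [Real.exp_nat_mul] at h_time h_freq
  exact ⟨⟨continuous_of_entire_ext hΦ hΦ_ext, h_time⟩,
    ⟨continuous_fourier_of_integrable φ.integrable, h_freq⟩⟩

theorem biRapid_poly (φ : GelfandShilov n) :
    BiRapid (fun t => Real.exp ‖t‖) (fun ξ => 1 + ‖ξ‖) φ := by
  refine ⟨φ.biRapid.fst, φ.biRapid.snd.continuous, fun k => ?_⟩
  obtain ⟨C, hC⟩ := φ.biRapid.snd.decay k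
  refine ⟨C, fun ξ => le_trans ?_ (hC ξ)⟩
  gcongr
  exact isBaseWeight_exp_norm.one_add_norm_le ξ

/-- The inclusion `Σ₁¹ ⊆ 𝒦₁`. -/
def toK1 (φ : GelfandShilov n) : K1 n :=
  ⟨φ, φ.biRapid_poly.contDiff isBaseWeight_exp_norm, fun k j => by
    obtain ⟨N, C, -, hC⟩ := exists_exp_mul_norm_iteratedFDeriv_le (RSpace n) j k
    obtain ⟨h_time, h_freq⟩ := (norm_weightedPair_le_iff isBaseWeight_exp_norm
      isBaseWeight_one_add_norm φ.biRapid_poly (k := N)).1 le_rfl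
    exact ⟨_, hC φ φ.biRapid_poly _ h_time h_freq⟩⟩

theorem exists_norm_le_norm_weightedPair (f : GelfandShilovDual n) : ∃ (k : ℕ) (C : ℝ),
    ∀ χ : GelfandShilov n, ‖f χ‖ ≤
      C * ‖weightedPair isBaseWeight_exp_norm isBaseWeight_exp_norm k χ.biRapid‖ := by
  obtain ⟨s, C, -, hC⟩ := Seminorm.bound_of_continuous (GelfandShilov.withSeminorms n)
    ((normSeminorm ℂ ℂ).comp f.toLinearMap) (continuous_norm.comp f.continuous)
  refine ⟨s.sup id, C * 2, fun χ => (hC χ).trans ?_⟩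
  obtain ⟨h_time, h_freq⟩ := (norm_weightedPair_le_iff isBaseWeight_exp_norm
    isBaseWeight_exp_norm χ.biRapid (k := s.sup id)).1 le_rfl
  rw [mul_assoc, two_mul, smul_apply, NNReal.smul_def, smul_eq_mul]
  gcongr
  refine Seminorm.finset_sup_apply_le (by positivity) fun k hk => ?_
  have hk : k ≤ s.sup id := Finset.le_sup (f := id) hk
  refine add_le_add (ciSup_le fun t => le_trans ?_ (h_time t))
    (ciSup_le fun ξ => le_trans ?_ (h_freq ξ))
  · rw [← Real.exp_nat_mul]
    change Real.exp (k * ‖t‖) * ‖χ t‖ ≤ _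
    gcongr
  · rw [← Real.exp_nat_mul]
    change Real.exp (k * ‖ξ‖) * ‖𝓕 (χ : RSpace n → ℂ) ξ‖ ≤ _
    gcongr

theorem reproducing_formula (φ : GelfandShilov n) (f : GelfandShilovDual n) :
    Continuous (fun p : RSpace n × RSpace n => stftGS φ f p.1 p.2) ∧
    ∀ χ : GelfandShilov n, ∫ p, gaborCoeff φ χ p * stftGS φ f p.1 p.2 =
        (∫ s, φ s * conj (φ s)) * f χ := by
  obtain ⟨k, C, hC⟩ := exists_norm_le_norm_weightedPair f
  have h := weak_reproducing_formula isBaseWeight_exp_norm isBaseWeight_exp_norm k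
    (GelfandShilov.coeₗ n) GelfandShilov.biRapid φ.biRapid
    (fun p => ⟨timeFreqFun φ p.1 (fun j => (p.2 j : ℂ)),
      timeFreqFun_mem_gelfandShilov φ.2 p.1 p.2⟩)
    (fun p => timeFreqFun_ofReal φ p.1 p.2) f.toLinearMap C hC
  exact ⟨h.1, fun χ => (h.2 χ).2⟩

end GelfandShilov

theorem stft_toK1_of_extends {F : K1Dual n} {f : GelfandShilovDual n} (h : Extends F f)
    (φ : GelfandShilov n) (x ξ : RSpace n) :
    stft φ.toK1 F x (fun j => (ξ j : ℂ)) = stftGS φ f x ξ :=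
  h _ _ fun _ => rfl

theorem modulationNormK1_toK1_of_extends {F : K1Dual n} {f : GelfandShilovDual n}
    (h : Extends F f) (φ : GelfandShilov n) (p q : ℝ≥0∞) (m : RSpace n × RSpace n → ℝ) :
    modulationNormK1 φ.toK1 p q m F = modulationNorm φ p q m f := by
  simp only [modulationNormK1, modulationNorm, stft_toK1_of_extends h]

theorem Rapid.integral_mul_conj_self_ne_zero {E : Type*} [NormedAddCommGroup E]
    [NormedSpace ℝ E] [FiniteDimensional ℝ E] [MeasurableSpace E] [BorelSpace E]
    {μ : Measure E} [μ.IsAddHaarMeasure] {ρ : E → ℝ} {f : E → ℂ}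
    (hf : Rapid ρ f) (hρ : IsBaseWeight ρ) (h0 : f ≠ 0) : ∫ s, f s * conj (f s) ∂μ ≠ 0 := by
  obtain ⟨C, hC⟩ := hf.exists_norm_le
  have h_cont := hf.continuous
  have hi : Integrable (fun s => ‖f s‖ ^ 2) μ := by
    simpa only [sq] using (hf.integrable hρ).norm.mul_bdd
      h_cont.norm.aestronglyMeasurable (.of_forall fun s => by simpa using hC s)
  obtain ⟨s, hs⟩ := Function.ne_iff.1 h0
  have h_pos : 0 < ∫ s, ‖f s‖ ^ 2 ∂μ :=
    integral_pos_of_integrable_nonneg_nonzero (by fun_prop) hi (fun s => by positivity)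
      (pow_ne_zero 2 (norm_ne_zero_iff.2 hs))
  simp only [Complex.mul_conj, Complex.normSq_eq_norm_sq, integral_complex_ofReal]
  exact Complex.ofReal_ne_zero.2 h_pos.ne'

theorem K1.integral_mul_conj_self_ne_zero {g : K1 n} (hg : g ≠ 0) :
    ∫ s, g s * conj (g s) ≠ 0 :=
  g.rapid.integral_mul_conj_self_ne_zero isBaseWeight_exp_norm fun h => hg (Subtype.ext h)

theorem GelfandShilov.toK1_ne_zero {φ : GelfandShilov n} (hφ : φ ≠ 0) : φ.toK1 ≠ 0 :=
  fun h => hφ (Subtype.ext (show (φ.toK1 : RSpace n → ℂ) = 0 from congrArg Subtype.val h))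

theorem eq_of_extends {φ : GelfandShilov n} (hφ : φ ≠ 0) {f : GelfandShilovDual n}
    {F₁ F₂ : K1Dual n} (h₁ : Extends F₁ f) (h₂ : Extends F₂ f) : F₁ = F₂ := by
  have hκ := K1.integral_mul_conj_self_ne_zero (GelfandShilov.toK1_ne_zero hφ)
  ext χ
  have e₁ := ((K1.reproducing_formula φ.toK1 F₁).2 χ).2
  have e₂ := ((K1.reproducing_formula φ.toK1 F₂).2 χ).2
  simp only [stft_toK1_of_extends h₁] at e₁
  simp only [stft_toK1_of_extends h₂] at e₂
  exact mul_left_cancel₀ hκ (e₁.symm.trans e₂)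

end Reproducing

/-! ### Change of window -/

section DecayMeasure

variable {E : Type*} [NormedAddCommGroup E] [NormedSpace ℝ E] [MeasurableSpace E]
  {μ : Measure E} {ρ σ : E → ℝ}

/-- The measure `ρ^{-(d+1)} μ`, where `d = dim E`: the least integral power for which it is finite
for every weight `ρ` dominating `1 + ‖t‖`. -/
def decayMeasure (ρ : E → ℝ) (μ : Measure E) : Measure E :=
  μ.withDensity fun t => ENNReal.ofReal (ρ t ^ (Module.finrank ℝ E + 1))⁻¹

theorem IsBaseWeight.decayMeasure_le (hρ : IsBaseWeight ρ) : decayMeasure ρ μ ≤ μ := by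
  conv_rhs => rw [← withDensity_one (μ := μ)]
  refine withDensity_mono (.of_forall fun t => ENNReal.ofReal_le_one.2 ?_)
  exact inv_le_one_of_one_le₀ (one_le_pow₀ (hρ.one_le t))

variable [BorelSpace E]

theorem lintegral_decayMeasure_prod [SFinite μ] (hρ : IsBaseWeight ρ) (hσ : IsBaseWeight σ)
    (f : E × E → ℝ≥0∞) :
    ∫⁻ z, f z ∂(decayMeasure ρ μ).prod (decayMeasure σ μ) =
      ∫⁻ z, ENNReal.ofReal ((ρ z.1 ^ (Module.finrank ℝ E + 1))⁻¹ *
        (σ z.2 ^ (Module.finrank ℝ E + 1))⁻¹) * f z ∂μ.prod μ := by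
  have hρ_meas := hρ.continuous.measurable
  have hσ_meas := hσ.continuous.measurable
  rw [decayMeasure, decayMeasure, prod_withDensity (by fun_prop) (by fun_prop),
    lintegral_withDensity_eq_lintegral_mul_non_measurable _ (by fun_prop)
      (.of_forall fun z => ENNReal.mul_lt_top ENNReal.ofReal_lt_top ENNReal.ofReal_lt_top)]
  refine lintegral_congr fun z => ?_
  rw [Pi.mul_apply, ENNReal.ofReal_mul (inv_nonneg.2 (hρ.pow_pos _ _).le)]

variable [FiniteDimensional ℝ E]

theorem IsBaseWeight.isFiniteMeasure_decayMeasure [μ.IsAddHaarMeasure] (hρ : IsBaseWeight ρ) :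
    IsFiniteMeasure (decayMeasure ρ μ) :=
  isFiniteMeasure_withDensity_ofReal hρ.integrable_inv_pow.2

theorem lintegral_enorm_mul_weight_le [μ.IsAddHaarMeasure] (hρ : IsBaseWeight ρ)
    (hσ : IsBaseWeight σ) {m : E × E → ℝ} (hm : ∀ p, 0 ≤ m p) {A D : ℝ} (hA : 0 ≤ A) {r : ℕ}
    (hmA : ∀ p z, m p ≤ A * (ρ z.1 ^ r * σ z.2 ^ r) * m (p + z)) {G : E × E → ℂ}
    (hG : ∀ z, ρ z.1 ^ (Module.finrank ℝ E + 1 + r) * σ z.2 ^ (Module.finrank ℝ E + 1 + r) *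
      ‖G z‖ ≤ D) (V : E × E → ℂ) (p : E × E) :
    ∫⁻ q, ‖G (q - p) * V q * (m p : ℂ)‖ₑ ∂μ.prod μ ≤ ENNReal.ofReal (A * D) *
      ∫⁻ z, ‖V (p + z) * (m (p + z) : ℂ)‖ₑ ∂(decayMeasure ρ μ).prod (decayMeasure σ μ) := by
  rw [← lintegral_add_left_eq_self _ p, lintegral_decayMeasure_prod hρ hσ,
    ← lintegral_const_mul' _ _ ENNReal.ofReal_ne_top]
  refine lintegral_mono fun z => ?_
  have hρz := hρ.pos z.1
  have hσz := hσ.pos z.2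
  have hmz := hm (p + z)
  have hD : 0 ≤ D := le_trans (by positivity) (hG z)
  rw [add_sub_cancel_left, ← ofReal_norm, ← ofReal_norm, ← ENNReal.ofReal_mul (by positivity),
    ← ENNReal.ofReal_mul (by positivity)]
  refine ENNReal.ofReal_le_ofReal ?_
  simp only [norm_mul, Complex.norm_real, Real.norm_of_nonneg (hm _)]
  set d := Module.finrank ℝ E + 1
  calc ‖G z‖ * ‖V (p + z)‖ * m p
      ≤ ‖G z‖ * ‖V (p + z)‖ * (A * (ρ z.1 ^ r * σ z.2 ^ r) * m (p + z)) := by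
        gcongr
        exact hmA p z
    _ = A * (ρ z.1 ^ (d + r) * σ z.2 ^ (d + r) * ‖G z‖) *
          ((ρ z.1 ^ d)⁻¹ * (σ z.2 ^ d)⁻¹ * (‖V (p + z)‖ * m (p + z))) := by
        field_simp
        ring
    _ ≤ A * D * ((ρ z.1 ^ d)⁻¹ * (σ z.2 ^ d)⁻¹ * (‖V (p + z)‖ * m (p + z))) := by
        gcongr
        exact hG z

end DecayMeasure

section ChangeOfWindow

variable {n : ℕ} {m : RSpace n × RSpace n → ℝ} {p q : ℝ≥0∞}

theorem IsWeightM1.exists_le (hm : IsWeightM1 m) : ∃ (A : ℝ) (r : ℕ), 0 ≤ A ∧ ∀ p z,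
    m p ≤ A * (Real.exp ‖z.1‖ ^ r * (1 + ‖z.2‖) ^ r) * m (p + z) := by
  obtain ⟨A, a, s, hA, -, -, h⟩ := hm.moderate
  obtain ⟨r, hr⟩ := exists_nat_ge (max a s)
  obtain ⟨har, hsr⟩ := max_le_iff.1 hr
  refine ⟨A, r, hA.le, fun p z => ?_⟩
  have hp : m p ≤ A * Real.exp (a * ‖z.1‖) * (1 + ‖z.2‖) ^ s * m (p + z) := by
    have h_mod := (div_le_iff₀ (hm.pos _)).1 (h (p + z).1 (p + z).2 (-z.1) (-z.2))
    simp only [Prod.fst_add, Prod.snd_add, add_neg_cancel_right, norm_neg] at h_mod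
    exact h_mod
  have h_poly : (1 + ‖z.2‖) ^ s ≤ (1 + ‖z.2‖) ^ r := by
    rw [← Real.rpow_natCast]
    exact Real.rpow_le_rpow_of_exponent_le (by linarith [norm_nonneg z.2]) hsr
  have hmz := (hm.pos (p + z)).le
  refine hp.trans ?_
  rw [mul_assoc A, ← Real.exp_nat_mul]
  gcongr

theorem K1.exists_pow_mul_pow_mul_norm_gaborCoeff_le (g : K1 n) (N : ℕ) :
    ∃ (k M : ℕ) (D : ℝ), 0 ≤ D ∧ ∀ (χ : K1 n) (z : RSpace n × RSpace n),
      Real.exp ‖z.1‖ ^ N * (1 + ‖z.2‖) ^ N * ‖gaborCoeff g χ z‖ ≤ D * sumSeminorm k M χ := by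
  obtain ⟨C, hC0, hC⟩ := exists_one_add_norm_pow_mul_norm_fourier_le n (2 * N)
  set k := max (2 * N) (n + 1)
  set I := ∫ s, Real.exp ‖s‖ ^ (2 * N) * ‖g s‖
  set J := ∫ s, (1 + ‖s‖) ^ (2 * N) * ‖𝓕 (g : RSpace n → ℂ) s‖
  have : 0 ≤ I := integral_nonneg fun s => by positivity
  have : 0 ≤ J := integral_nonneg fun s => by positivity
  refine ⟨k, 2 * N, I + C * J, by positivity, fun χ z => ?_⟩
  have h_time (t : RSpace n) : Real.exp ‖t‖ ^ (2 * N) * ‖χ t‖ ≤ sumSeminorm k (2 * N) χ :=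
    (exp_pow_mul_norm_le χ (2 * N) t).trans ((seminorm_mono χ (le_max_left _ _) 0).trans
      (seminorm_le_sumSeminorm k (2 * N) χ (Nat.zero_le _)))
  have h_freq (ξ : RSpace n) : (1 + ‖ξ‖) ^ (2 * N) * ‖𝓕 (χ : RSpace n → ℂ) ξ‖ ≤
      C * sumSeminorm k (2 * N) χ :=
    (hC χ ξ).trans (by gcongr; exact sumSeminorm_mono χ (le_max_right _ _) le_rfl)
  refine (pow_mul_pow_mul_norm_gaborCoeff_le isBaseWeight_exp_norm isBaseWeight_one_add_norm
    g.biRapid (χ.rapid.integrable isBaseWeight_exp_norm) h_time h_freq z).trans_eq ?_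
  ring

/-- The finite measure `e^{-(n+1)|x|} (1 + |ξ|)^{-(n+1)} dx dξ` on phase space, against which
short-time Fourier transforms are averaged. -/
def phaseMeasure (n : ℕ) : Measure (RSpace n × RSpace n) :=
  (decayMeasure (fun x => Real.exp ‖x‖) volume).prod (decayMeasure (fun ξ => 1 + ‖ξ‖) volume)

instance : IsFiniteMeasure (phaseMeasure n) :=
  have := (isBaseWeight_exp_norm (E := RSpace n)).isFiniteMeasure_decayMeasure (μ := volume)
  have := (isBaseWeight_one_add_norm (E := RSpace n)).isFiniteMeasure_decayMeasure (μ := volume)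
  Measure.prod.instIsFiniteMeasure _ _

theorem exists_lintegral_gaborCoeff_mul_le (hm : IsWeightM1 m) (g : K1 n) :
    ∃ (k M : ℕ) (D : ℝ), 0 ≤ D ∧ ∀ (χ : K1 n) (V : RSpace n × RSpace n → ℂ) p,
      ∫⁻ q, ‖gaborCoeff g χ (q - p) * V q * (m p : ℂ)‖ₑ ≤
        ENNReal.ofReal (D * K1.sumSeminorm k M χ) *
          ∫⁻ z, ‖V (p + z) * (m (p + z) : ℂ)‖ₑ ∂phaseMeasure n := by
  obtain ⟨A, r, hA, hmA⟩ := hm.exists_le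
  obtain ⟨k, M, D, hD0, hD⟩ := g.exists_pow_mul_pow_mul_norm_gaborCoeff_le
    (Module.finrank ℝ (RSpace n) + 1 + r)
  refine ⟨k, M, A * D, by positivity, fun χ V p => ?_⟩
  rw [mul_assoc A]
  exact lintegral_enorm_mul_weight_le isBaseWeight_exp_norm isBaseWeight_one_add_norm
    (fun p => (hm.pos p).le) hA hmA (hD χ) V p

theorem K1.exists_enorm_stft_mul_weight_le (hm : IsWeightM1 m) {g : K1 n} (hg : g ≠ 0) :
    ∃ (k M : ℕ) (D : ℝ), 0 ≤ D ∧ ∀ (F : K1Dual n) (χ : K1 n) (x ξ : RSpace n),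
      ‖stft χ F x (fun j => (ξ j : ℂ)) * (m (x, ξ) : ℂ)‖ₑ ≤
        ∫⁻ z, ‖stft g F (x + z.1) (fun j => ((ξ + z.2) j : ℂ)) * (m (x + z.1, ξ + z.2) : ℂ)‖ₑ
          ∂(ENNReal.ofReal (D * sumSeminorm k M χ) • phaseMeasure n) := by
  obtain ⟨k, M, D, hD0, hD⟩ := exists_lintegral_gaborCoeff_mul_le hm g
  have hκ := K1.integral_mul_conj_self_ne_zero hg
  set κ := ∫ s, g s * conj (g s)
  refine ⟨k, M, ‖κ⁻¹‖ * D, by positivity, fun F χ x ξ => ?_⟩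
  set V : RSpace n × RSpace n → ℂ := fun y => stft g F y.1 (fun j => (y.2 j : ℂ))
  have h_stft : stft χ F x (fun j => (ξ j : ℂ)) =
      κ⁻¹ * ∫ y, gaborCoeff g (gaborAtom χ (x, ξ)) y * V y := by
    rw [eq_inv_mul_iff_mul_eq₀ hκ, ← timeFreqFun_ofReal]
    exact ((reproducing_formula g F).2 (χ.timeFreq x (fun j => (ξ j : ℂ)))).2.symm
  have h_covariance (y : RSpace n × RSpace n) :
      ‖gaborCoeff g (gaborAtom χ (x, ξ)) y‖ₑ = ‖gaborCoeff g χ.conjugate (y - (x, ξ))‖ₑ := by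
    rw [← ofReal_norm, norm_gaborCoeff_gaborAtom, ofReal_norm]
    rfl
  rw [h_stft, mul_assoc, ← integral_mul_const, enorm_mul, lintegral_smul_measure, smul_eq_mul,
    mul_assoc, ENNReal.ofReal_mul (norm_nonneg _), mul_assoc, ofReal_norm]
  gcongr
  refine (enorm_integral_le_lintegral_enorm _).trans ?_
  simp only [enorm_mul, h_covariance]
  have h_bound := hD χ.conjugate V (x, ξ)
  simp only [enorm_mul, sumSeminorm_conjugate] at h_bound
  exact h_bound

theorem measurable_enorm_mul_weight (hm : IsWeightM1 m) {V : RSpace n → RSpace n → ℂ}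
    (hV : Continuous (Function.uncurry V)) :
    Measurable (Function.uncurry fun x ξ => ‖V x ξ * (m (x, ξ) : ℂ)‖ₑ) :=
  (hV.measurable.mul (Complex.measurable_ofReal.comp hm.measurable)).enorm

theorem mixedNorm_eq_eLpNorm_enorm (p q : ℝ≥0∞) (m : RSpace n × RSpace n → ℝ)
    (V : RSpace n → RSpace n → ℂ) : mixedNorm p q m V =
      eLpNorm (fun ξ => eLpNorm (fun x => ‖V x ξ * (m (x, ξ) : ℂ)‖ₑ) p volume) q volume := by
  simp only [mixedNorm, eLpNorm_enorm]

theorem K1.exists_modulationNormK1_le (hm : IsWeightM1 m) (hp : 1 ≤ p) (hq : 1 ≤ q) {g : K1 n}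
    (hg : g ≠ 0) : ∃ (k M : ℕ) (D : ℝ), 0 ≤ D ∧ ∀ (F : K1Dual n) (χ : K1 n),
      modulationNormK1 χ p q m F ≤
        ENNReal.ofReal (D * sumSeminorm k M χ) * modulationNormK1 g p q m F := by
  obtain ⟨k, M, D, hD0, hD⟩ := exists_enorm_stft_mul_weight_le hm hg
  refine ⟨k, M, (phaseMeasure n).real Set.univ * D, by positivity, fun F χ => ?_⟩
  have h_meas := measurable_enorm_mul_weight hm
    (V := fun x ξ => stft g F x (fun j => (ξ j : ℂ))) (reproducing_formula g F).1
  rw [modulationNormK1, modulationNormK1, mixedNorm_eq_eLpNorm_enorm, mixedNorm_eq_eLpNorm_enorm]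
  have h_young := eLpNorm_eLpNorm_lintegral_add_le (μ := volume) (ν := volume)
    (ENNReal.ofReal (D * sumSeminorm k M χ) • phaseMeasure n) h_meas hp hq
  refine le_trans ?_ (h_young.trans_eq ?_)
  · refine eLpNorm_mono_enorm fun ξ => ?_
    simp only [enorm_eq_self]
    refine eLpNorm_mono_enorm fun x => ?_
    simpa only [enorm_eq_self] using hD F χ x ξ
  · rw [Measure.smul_apply, smul_eq_mul, mul_assoc, mul_assoc _ D,
      ENNReal.ofReal_mul measureReal_nonneg, ofReal_measureReal, mul_left_comm, mul_assoc]

end ChangeOfWindow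

/-! ### Extension to `𝒦₁` -/

section Extension

variable {n : ℕ} {m : RSpace n × RSpace n → ℝ} {p q : ℝ≥0∞}

theorem lintegral_phaseMeasure_lt_top (hm : IsWeightM1 m) (hp : 1 ≤ p) (hq : 1 ≤ q)
    {V : RSpace n → RSpace n → ℂ} (hV : Continuous (Function.uncurry V))
    (hfin : mixedNorm p q m V < ⊤) :
    ∫⁻ z, ‖V z.1 z.2 * (m z : ℂ)‖ₑ ∂phaseMeasure n < ⊤ := by
  rw [mixedNorm_eq_eLpNorm_enorm] at hfin
  have := (isBaseWeight_exp_norm (E := RSpace n)).isFiniteMeasure_decayMeasure (μ := volume)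
  have := (isBaseWeight_one_add_norm (E := RSpace n)).isFiniteMeasure_decayMeasure (μ := volume)
  exact lintegral_prod_lt_top_of_eLpNorm_eLpNorm_lt_top isBaseWeight_exp_norm.decayMeasure_le
    isBaseWeight_one_add_norm.decayMeasure_le (measurable_enorm_mul_weight hm hV) hp hq hfin

theorem exists_lintegral_gaborCoeff_mul_le_of_mixedNorm_lt_top (hm : IsWeightM1 m) (hp : 1 ≤ p)
    (hq : 1 ≤ q) (g : K1 n) {V : RSpace n → RSpace n → ℂ}
    (hV : Continuous (Function.uncurry V)) (hfin : mixedNorm p q m V < ⊤) :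
    ∃ (k M : ℕ) (C : ℝ), ∀ χ : K1 n,
      ∫⁻ y, ‖gaborCoeff g χ y * V y.1 y.2‖ₑ ≤ ENNReal.ofReal (C * K1.sumSeminorm k M χ) := by
  obtain ⟨k, M, D, -, hD⟩ := exists_lintegral_gaborCoeff_mul_le hm g
  have hm₀ := hm.pos 0
  set R := ∫⁻ z, ‖V z.1 z.2 * (m z : ℂ)‖ₑ ∂phaseMeasure n
  have hR : R ≠ ⊤ := (lintegral_phaseMeasure_lt_top hm hp hq hV hfin).ne
  refine ⟨k, M, R.toReal * D / m 0, fun χ => ?_⟩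
  have h_origin := hD χ (Function.uncurry V) 0
  simp only [sub_zero, zero_add, enorm_mul _ (m 0 : ℂ)] at h_origin
  rw [lintegral_mul_const' _ _ enorm_ne_top, ← ofReal_norm (m 0 : ℂ), Complex.norm_real,
    Real.norm_of_nonneg hm₀.le] at h_origin
  rw [div_mul_eq_mul_div, ENNReal.ofReal_div_of_pos hm₀, mul_assoc,
    ENNReal.ofReal_mul ENNReal.toReal_nonneg, ENNReal.ofReal_toReal hR, mul_comm R,
    ENNReal.le_div_iff_mul_le (.inl (ENNReal.ofReal_pos.2 hm₀).ne') (.inl ENNReal.ofReal_ne_top)]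
  exact h_origin

theorem K1.continuous_of_norm_le_sumSeminorm (L : K1 n →ₗ[ℂ] ℂ) {k M : ℕ} {C : ℝ}
    (hL : ∀ χ, ‖L χ‖ ≤ C * sumSeminorm k M χ) : Continuous L := by
  have := (K1.withSeminorms n).topologicalAddGroup
  refine continuous_of_continuousAt_zero L ?_
  rw [ContinuousAt, map_zero]
  have h_bound : Continuous fun χ : K1 n => C * sumSeminorm k M χ :=
    continuous_const.mul
      (continuous_finsetSum _ fun j _ => (K1.withSeminorms n).continuous_seminorm (k, j))
  refine squeeze_zero_norm hL ?_
  simpa only [sumSeminorm, map_zero, Finset.sum_const_zero, mul_zero] using h_bound.tendsto 0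

theorem K1.exists_dual_apply_eq_integral (g : K1 n) {V : RSpace n × RSpace n → ℂ}
    (hV : Continuous V) {k M : ℕ} {C : ℝ}
    (hC : ∀ χ : K1 n, ∫⁻ y, ‖gaborCoeff g χ y * V y‖ₑ ≤ ENNReal.ofReal (C * sumSeminorm k M χ)) :
    ∃ F : K1Dual n, ∀ χ : K1 n, F χ = ∫ y, gaborCoeff g χ y * V y := by
  have h_int (χ : K1 n) : Integrable χ := χ.rapid.integrable isBaseWeight_exp_norm
  have h_prod (χ : K1 n) : Integrable fun y => gaborCoeff g χ y * V y :=
    ⟨((continuous_gaborCoeff g.rapid (h_int χ)).mul hV).aestronglyMeasurable,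
      (hC χ).trans_lt ENNReal.ofReal_lt_top⟩
  let L : K1 n →ₗ[ℂ] ℂ :=
    { toFun χ := ∫ y, gaborCoeff g χ y * V y
      map_add' χ χ' := by
        rw [← integral_add (h_prod χ) (h_prod χ')]
        refine integral_congr_ae (.of_forall fun y => ?_)
        exact (congrArg (· * V y) (gaborCoeff_add g.rapid (h_int χ) (h_int χ') y)).trans
          (add_mul _ _ _)
      map_smul' c χ := by
        rw [RingHom.id_apply, smul_eq_mul, ← integral_const_mul]
        refine integral_congr_ae (.of_forall fun y => ?_)
        exact (congrArg (· * V y) (gaborCoeff_smul g χ c y)).trans (mul_assoc _ _ _) }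
  refine ⟨⟨L, continuous_of_norm_le_sumSeminorm L (k := k) (M := M) (C := |C|) fun χ => ?_⟩,
    fun χ => rfl⟩
  have hS := sumSeminorm_nonneg k M χ
  refine (norm_integral_le_lintegral_norm _).trans
    (ENNReal.toReal_le_of_le_ofReal (by positivity) ?_)
  simp only [ofReal_norm]
  refine (hC χ).trans (ENNReal.ofReal_le_ofReal ?_)
  gcongr
  exact le_abs_self C

theorem exists_extends (hm : IsWeightM1 m) (hp : 1 ≤ p) (hq : 1 ≤ q) {φ : GelfandShilov n}
    (hφ : φ ≠ 0) {f : GelfandShilovDual n} (hf : f ∈ modulationSpace φ p q m) :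
    ∃ F : K1Dual n, Extends F f := by
  have hκ := K1.integral_mul_conj_self_ne_zero (GelfandShilov.toK1_ne_zero hφ)
  obtain ⟨h_cont, h_repr⟩ := φ.reproducing_formula f
  obtain ⟨k, M, C, hC⟩ :=
    exists_lintegral_gaborCoeff_mul_le_of_mixedNorm_lt_top hm hp hq φ.toK1 (V := stftGS φ f)
      h_cont hf
  obtain ⟨L, hL⟩ := φ.toK1.exists_dual_apply_eq_integral h_cont hC
  refine ⟨(∫ s, φ.toK1 s * conj (φ.toK1 s))⁻¹ • L, fun χ χ' h => ?_⟩
  have h_coe : (χ : RSpace n → ℂ) = χ' := funext h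
  rw [smul_apply, smul_eq_mul, hL, h_coe]
  exact (congrArg _ (h_repr χ')).trans (inv_mul_cancel_left₀ hκ _)

end Extension

theorem exists_mixedNorm_stft_complexPoint_le {n : ℕ} {m : RSpace n × RSpace n → ℝ} {p q : ℝ≥0∞}
    (hm : IsWeightM1 m) (hp : 1 ≤ p) (hq : 1 ≤ q) {g : K1 n} (hg : g ≠ 0) (ψ : K1 n) (lam : ℝ) :
    ∃ C, ∀ (F : K1Dual n) (η : RSpace n), ‖η‖ ≤ lam →
      mixedNorm p q m (fun x ξ =>
          (Real.exp (-2 * Real.pi * inner ℝ x η) : ℂ) * stft ψ F x (complexPoint ξ η)) ≤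
        ENNReal.ofReal C * modulationNormK1 g p q m F := by
  obtain ⟨k, M, D, hD0, hD⟩ := K1.exists_modulationNormK1_le hm hp hq hg
  obtain ⟨S, hS⟩ := K1.exists_sumSeminorm_tilt_le ψ lam k M
  refine ⟨D * S, fun F η hη => ?_⟩
  simp only [exp_mul_stft_complexPoint]
  refine (hD F (ψ.tilt η)).trans ?_
  gcongr
  exact hS η hη

end

theorem mainTheorem11 {n : ℕ} (m : RSpace n × RSpace n → ℝ) (hm : IsWeightM1 m)
    (p q : ℝ≥0∞) (hp : 1 ≤ p) (hq : 1 ≤ q)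
    (φ : GelfandShilov n) (hφ : φ ≠ 0) (γ : K1 n) (hγ : γ ≠ 0) (ψ : K1 n) (hψ : ψ ≠ 0) :
    (∀ f ∈ modulationSpace φ p q m, ∃! F : K1Dual n, Extends F f) ∧
    ∀ lam : ℝ, 0 ≤ lam → ∃ C : ℝ, 0 < C ∧
      ∀ f ∈ modulationSpace φ p q m, ∀ F : K1Dual n, Extends F f →
        (∀ x : RSpace n, Differentiable ℂ (stft ψ F x)) ∧
        ∀ η : RSpace n, ‖η‖ ≤ lam →
          mixedNorm p q m (fun x ξ =>
              (Real.exp (-2 * Real.pi * inner ℝ x η) : ℂ) * stft ψ F x (complexPoint ξ η))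
            ≤ ENNReal.ofReal C * modulationNorm φ p q m f ∧
          mixedNorm p q m (fun x ξ =>
              (Real.exp (-2 * Real.pi * inner ℝ x η) : ℂ) * stft ψ F x (complexPoint ξ η))
            ≤ ENNReal.ofReal C * modulationNormK1 γ p q m F := by
  refine ⟨fun f hf => ?_, fun lam _ => ?_⟩
  · obtain ⟨F, hF⟩ := exists_extends hm hp hq hφ hf
    exact ⟨F, hF, fun F' hF' => eq_of_extends hφ hF' hF⟩
  obtain ⟨C₁, h₁⟩ := exists_mixedNorm_stft_complexPoint_le hm hp hq
    (GelfandShilov.toK1_ne_zero hφ) ψ lam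
  obtain ⟨C₂, h₂⟩ := exists_mixedNorm_stft_complexPoint_le hm hp hq hγ ψ lam
  have hC₁ : C₁ ≤ max 1 (max C₁ C₂) := (le_max_left _ _).trans (le_max_right _ _)
  have hC₂ : C₂ ≤ max 1 (max C₁ C₂) := (le_max_right _ _).trans (le_max_right _ _)
  refine ⟨max 1 (max C₁ C₂), lt_max_of_lt_left one_pos, fun f _ F hF =>
    ⟨differentiable_stft ψ F, fun η hη => ⟨?_, ?_⟩⟩⟩
  · rw [← modulationNormK1_toK1_of_extends hF]
    exact (h₁ F η hη).trans (by gcongr)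
  · exact (h₂ F η hη).trans (by gcongr)
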